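/- Notation. For a unit vector $\eta\in S^2\subset\mathbb R^3$ and $p\in\mathbb R$, and a bounded, compactly supported measurable vector field $\mathbf f$ on $\mathbb R^3$, let $\mathbf R\mathbf f(p,\eta)=\int_{\{y\,:\,y\cdot\eta=p\}}\mathbf f(y)\,dy$ be the (componentwise) Radon transform, let $\mathbf R^{(nor)}\mathbf f(p,\eta)=(\eta\cdot\mathbf R\mathbf f(p,\eta))\,\eta$ and $\mathbf R^{(tan)}\mathbf f=\mathbf R\mathbf f-\mathbf R^{(nor)}\mathbf f$ be its normal and tangential parts, and let $$\mathbf f^{(1)}(x)=-\frac1{8\pi^2}\int_{S^2}\partial_p^2\mathbf R^{(tan)}\mathbf f(p,\eta)\big|_{p=\eta\cdot x}\,d\eta$$ be the first part of $\mathbf f$ (the Radon inversion formula applied to the tangential part only). For an open set $D$, a field $\mathbf f^s$ is the solenoidal part of $\mathbf f$ in $D$ if $\mathbf f=\mathbf f^s+\nabla\varphi$ and $\nabla\cdot\mathbf f^s=0$ in $D$ for some $\varphi\in C^2(D)\cap C(\overline D)$ with $\varphi=0$ on $\partial D$. The second part of $\mathbf f$ is $\mathbf f^{(2)}=\mathbf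 f^s-\mathbf f^{(1)}$. (1) Let $D\subset\mathbb R^3$ be a bounded convex open set with smooth boundary, and let $\mathbf f$ be a real vector field that is smooth on $\overline D$ (up to the boundary, i.e. equal there to the restriction of a smooth field on $\mathbb R^3$) and zero outside $\overline D$. Then for $x\in D$ the derivative and the integral defining $\mathbf f^{(1)}(x)$ exist: for every $\eta\in S^2$ the function $p\mapsto\mathbf R^{(tan)}\mathbf f(p,\eta)$ is $C^2$ near $p=\eta\cdot x$, and the integrand is integrable over $S^2$. The field $\mathbf f^{(1)}$ is differentiable in $D$, and $$\nabla\times\mathbf f=\nabla\times\mathbf f^{(1)},\qquad \nabla\cdot\mathbf f^{(1)}=0\qquad\text{in } D.$$ Hence, if $\mathbf f^s$ is the solenoidal part of $\mathbf f$ in $D$, there is a harmonic function $h$ on $D$ (that is, $\Delta h=0$) with $\mathbf f^s-\mathbf f^{(1)}=\nabla h$ in $D$. (2) Let $D=B^3$ be the open unit ball, and let $\mathbf f$ be as in (1). If $\nabla\cdot\mathbf f=0$ in $B^3$ and $\mathbf f(\eta)\cdot\eta=0$ for all $\eta\in S^2$, then $\mathbf f^{(2)}=0$ in $B^3$. -/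

import Mathlib

open scoped ContDiff

noncomputable section

/-- Euclidean three-space. -/
abbrev E3 : Type := EuclideanSpace ℝ (Fin 3)

/-- The unit sphere `S²`, as a type. -/
abbrev S2 : Type := Metric.sphere (0 : E3) 1

/-- `∂ᵢ Fⱼ (x)`. -/
def partialDeriv (i j : Fin 3) (F : E3 → E3) (x : E3) : ℝ :=
  (fderiv ℝ F x (EuclideanSpace.single i 1)) j

/-- Divergence of a vector field. -/
def divergence (F : E3 → E3) (x : E3) : ℝ :=
  ∑ i, partialDeriv i i F x

/-- Curl of a vector field. -/
def curl (F : E3 → E3) (x : E3) : E3 :=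
  !₂[partialDeriv 1 2 F x - partialDeriv 2 1 F x,
     partialDeriv 2 0 F x - partialDeriv 0 2 F x,
     partialDeriv 0 1 F x - partialDeriv 1 0 F x]

/-- The open set `D` has a smooth boundary: near each of its boundary points it is the
sublevel set of a smooth function with non-vanishing differential at that point. -/
def HasSmoothBoundary (D : Set E3) : Prop :=
  ∀ x ∈ frontier D, ∃ ρ : E3 → ℝ, ContDiff ℝ ∞ ρ ∧ fderiv ℝ ρ x ≠ 0 ∧
    ∀ᶠ y in nhds x, (y ∈ D ↔ ρ y < 0)

/-- `f` is smooth up to the boundary on the closure of `D` (it is there the restriction of a smooth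
field on the whole space) and is zero outside the closure of `D`. -/
def IsSmoothFieldSupportedIn (D : Set E3) (f : E3 → E3) : Prop :=
  (∃ F : E3 → E3, ContDiff ℝ ∞ F ∧ Set.EqOn f F (closure D)) ∧ ∀ x ∉ closure D, f x = 0

/-- Componentwise Radon transform: the integral of `f` over the plane `{y | ⟪η, y⟫ = p}`
with respect to its two-dimensional Lebesgue measure (for unit vectors `η`). -/
def radon (f : E3 → E3) (p : ℝ) (η : E3) : E3 :=
  ∫ y : (Submodule.span ℝ {η})ᗮ, f (p • η + (y : E3))

/-- Normal component of the Radon transform. -/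
def radonNor (f : E3 → E3) (p : ℝ) (η : E3) : E3 :=
  (inner ℝ η (radon f p η)) • η

/-- Tangential component of the Radon transform. -/
def radonTan (f : E3 → E3) (p : ℝ) (η : E3) : E3 :=
  radon f p η - radonNor f p η

/-- `(∂_p² R^{tan} f)(p, η)` at `p = ⟪η, x⟫`. -/
def radonTanSecond (f : E3 → E3) (x : E3) (η : S2) : E3 :=
  iteratedDeriv 2 (fun p : ℝ => radonTan f p (η : E3)) (inner ℝ (η : E3) x)

/-- The surface measure of `S²` (of total mass `4π`). -/
def surfaceMeasure : MeasureTheory.Measure S2 :=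
  (MeasureTheory.volume : MeasureTheory.Measure E3).toSphere

/-- The first part `f⁽¹⁾`: the Radon inversion formula
`-(1 / 8π²) ∫_{S²} ∂_p² R f (⟪η, x⟫, η) dη` applied to the tangential part of `R f`. -/
def firstPart (f : E3 → E3) (x : E3) : E3 :=
  (-(1 / (8 * Real.pi ^ 2))) • ∫ η, radonTanSecond f x η ∂surfaceMeasure

/-- `fs` is, on `D`, the solenoidal part of `f`: `f = fs + ∇φ` and `div fs = 0` in `D`, where the
potential `φ` vanishes on the boundary of `D`. -/
def IsSolenoidalPart (D : Set E3) (f fs : E3 → E3) : Prop :=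
  ∃ φ : E3 → ℝ, ContDiffOn ℝ 2 φ D ∧ ContinuousOn φ (closure D) ∧ (∀ x ∈ frontier D, φ x = 0) ∧
    (∀ x ∈ D, f x = fs x + gradient φ x) ∧ ∀ x ∈ D, divergence fs x = 0

/-- The second part `f⁽²⁾` of the decomposition `f^s = f⁽¹⁾ + f⁽²⁾` of the solenoidal part `fs`
of `f`. -/
def secondPart (f fs : E3 → E3) (x : E3) : E3 :=
  fs x - firstPart f x

end

open Filter Topology MeasureTheory Set Metric

/-! For each direction `η` the tangential part of the backprojection is a superposition of plane
waves `x ↦ a (η · x)` with `a ⊥ η`, hence divergence free, while the normal part is a superposition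
of plane waves `x ↦ b (η · x) η`, hence a gradient. Since the two add up to `f` by the Radon
inversion formula, `f⁽¹⁾` and `f` differ by the gradient of `normalPotential f`.

The inversion formula comes from integrating `f` over slabs: the second difference of a slab
integral in the width of the slab is to leading order a multiple of `∂ₚ² R f`, while its average
over all directions is, by Archimedes' theorem that the projection of the sphere measure to an axis
is uniform, the convolution of `f` with an explicit radial kernel, up to a constant factor an
approximate identity.

All differentiations under the integral sign need `R f (·, η)` to be smooth near `η · x`, uniformly
in `η`. For `x` in a smooth convex domain the plane sections are star-shaped about a point near `x`,
with an exit radius that is smooth by the implicit function theorem, so in polar coordinates `R f`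
is an integral over a fixed compact set.

In the ball, testing the divergence theorem against functions of `η · y` shows that the normal part
of `R f` vanishes when `f` is solenoidal and tangential to the sphere; then `f⁽¹⁾ = f`, and the
potential in the decomposition of `f` is zero by the maximum principle. -/

lemma eventually_eq_zero_of_mem_frontier {X : Type*} [TopologicalSpace X] {D : Set X}
    (hD : IsOpen D) {b : X} {ρ : X → ℝ} (hρ : Continuous ρ)
    (hρD : ∀ᶠ y in 𝓝 b, (y ∈ D ↔ ρ y < 0)) :
    ∀ᶠ y in 𝓝 b, y ∈ frontier D → ρ y = 0 := by
  filter_upwards [eventually_eventually_nhds.2 hρD] with y hy hyf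
  rw [hD.frontier_eq] at hyf
  refine le_antisymm (le_of_not_gt fun hpos => ?_)
    (le_of_not_gt fun hneg => hyf.2 (hy.self_of_nhds.2 hneg))
  refine mem_closure_iff_frequently.1 hyf.1 ?_
  filter_upwards [hy, hρ.continuousAt.eventually (lt_mem_nhds hpos)] with y' hy' hpos' hD'
  exact (hy'.1 hD').asymm hpos'

lemma preimage_add_mem_nhds_zero {G : Type*} [TopologicalSpace G] [AddMonoid G] [ContinuousAdd G]
    {D : Set G} {z : G} (hD : IsOpen D) (hz : z ∈ D) : (z + ·) ⁻¹' D ∈ 𝓝 (0 : G) :=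
  (hD.preimage (continuous_const_add z)).mem_nhds (by simpa using hz)

section ExitRadius

variable {E : Type*} [NormedAddCommGroup E] [NormedSpace ℝ E] {D : Set E} {z v : E}

/-- The distance from `p.1`, in units of `p.2`, at which the ray from `p.1` in direction `p.2`
leaves `D`. It is the inverse of the Minkowski gauge of `D` translated by `-p.1`, so it has this
meaning only for convex `D` containing `p.1`. -/
noncomputable def exitRadius (D : Set E) (p : E × E) : ℝ :=
  (gauge ((p.1 + ·) ⁻¹' D) p.2)⁻¹

lemma exitRadius_pos (hD : IsOpen D) (hb : Bornology.IsBounded D) (hz : z ∈ D) (hv : v ≠ 0) :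
    0 < exitRadius D (z, v) := by
  have hT : Bornology.IsBounded ((z + ·) ⁻¹' D) :=
    (AntilipschitzWith.of_le_mul_dist fun x y => by simp :
      AntilipschitzWith 1 (z + ·)).isBounded_preimage hb
  exact inv_pos.2 ((gauge_pos (absorbent_nhds_zero (preimage_add_mem_nhds_zero hD hz))
    (NormedSpace.isVonNBounded_of_isBounded ℝ hT)).2 hv)

lemma add_smul_mem_iff_lt_exitRadius (hD : IsOpen D) (hc : Convex ℝ D)
    (hb : Bornology.IsBounded D) (hz : z ∈ D) (hv : v ≠ 0) {s : ℝ} (hs : 0 ≤ s) :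
    z + s • v ∈ D ↔ s < exitRadius D (z, v) := by
  have hmem := gauge_lt_one_iff_mem_interior (x := s • v) (hc.translate_preimage_right z)
    (preimage_add_mem_nhds_zero hD hz)
  rw [(hD.preimage (continuous_const_add z)).interior_eq, gauge_smul_of_nonneg hs, smul_eq_mul,
    ← lt_div_iff₀ (inv_pos.1 (exitRadius_pos hD hb hz hv)), one_div] at hmem
  exact hmem.symm

lemma add_smul_mem_closure_iff_le_exitRadius (hD : IsOpen D) (hc : Convex ℝ D)
    (hb : Bornology.IsBounded D) (hz : z ∈ D) (hv : v ≠ 0) {s : ℝ} (hs : 0 ≤ s) :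
    z + s • v ∈ closure D ↔ s ≤ exitRadius D (z, v) := by
  have hmem := gauge_le_one_iff_mem_closure (x := s • v) (hc.translate_preimage_right z)
    (preimage_add_mem_nhds_zero hD hz)
  rw [gauge_smul_of_nonneg hs, smul_eq_mul,
    ← le_div_iff₀ (inv_pos.1 (exitRadius_pos hD hb hz hv)), one_div] at hmem
  exact (hmem.trans (((Homeomorph.addLeft z).preimage_closure D).symm ▸ Iff.rfl)).symm

lemma add_exitRadius_smul_mem_frontier (hD : IsOpen D) (hc : Convex ℝ D)
    (hb : Bornology.IsBounded D) (hz : z ∈ D) (hv : v ≠ 0) :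
    z + exitRadius D (z, v) • v ∈ frontier D := by
  have hpos := (exitRadius_pos hD hb hz hv).le
  rw [hD.frontier_eq]
  exact ⟨(add_smul_mem_closure_iff_le_exitRadius hD hc hb hz hv hpos).2 le_rfl,
    fun h => ((add_smul_mem_iff_lt_exitRadius hD hc hb hz hv hpos).1 h).false⟩

lemma continuousAt_exitRadius (hD : IsOpen D) (hc : Convex ℝ D) (hb : Bornology.IsBounded D)
    (hz : z ∈ D) (hv : v ≠ 0) : ContinuousAt (exitRadius D) (z, v) := by
  have hadm : ∀ᶠ p : E × E in 𝓝 (z, v), p.1 ∈ D ∧ p.2 ≠ 0 :=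
    (continuous_fst.continuousAt.eventually (hD.mem_nhds hz)).and
      (continuous_snd.continuousAt.eventually_ne hv)
  have hray (s : ℝ) : Continuous fun p : E × E => p.1 + s • p.2 := by fun_prop
  rw [ContinuousAt, tendsto_order]
  constructor
  · intro a ha
    obtain ⟨s, has, hs⟩ := exists_between (max_lt ha (exitRadius_pos hD hb hz hv))
    obtain ⟨has, hs0⟩ := max_lt_iff.1 has
    filter_upwards [hadm, (hray s).continuousAt.eventually (hD.mem_nhds
      ((add_smul_mem_iff_lt_exitRadius hD hc hb hz hv hs0.le).2 hs))] with p hp hps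
    exact has.trans ((add_smul_mem_iff_lt_exitRadius hD hc hb hp.1 hp.2 hs0.le).1 hps)
  · intro a ha
    obtain ⟨s, hs, hsa⟩ := exists_between ha
    have hs0 : 0 ≤ s := (exitRadius_pos hD hb hz hv).le.trans hs.le
    have hout : z + s • v ∉ closure D := fun h =>
      hs.not_ge ((add_smul_mem_closure_iff_le_exitRadius hD hc hb hz hv hs0).1 h)
    filter_upwards [hadm, (hray s).continuousAt.eventually
      (isClosed_closure.isOpen_compl.mem_nhds hout)] with p hp hps
    exact (lt_of_not_ge fun h =>
      hps ((add_smul_mem_closure_iff_le_exitRadius hD hc hb hp.1 hp.2 hs0).2 h)).trans hsa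

lemma fderiv_definingFunction_nonpos (hD : IsOpen D) (hc : Convex ℝ D) {b : E}
    (hb : b ∈ frontier D) {ρ : E → ℝ} (hρ : Differentiable ℝ ρ)
    (hρD : ∀ᶠ y in 𝓝 b, (y ∈ D ↔ ρ y < 0)) (hz : z ∈ D) : fderiv ℝ ρ b (z - b) ≤ 0 := by
  have hρb : ρ b = 0 :=
    (eventually_eq_zero_of_mem_frontier hD hρ.continuous hρD).self_of_nhds hb
  have hline : HasLineDerivAt ℝ ρ (fderiv ℝ ρ b (z - b)) b (z - b) :=
    (hρ b).hasFDerivAt.hasLineDerivAt _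
  have htendsto : Tendsto (fun t : ℝ => b + t • (z - b)) (𝓝[>] 0) (𝓝 b) := by
    have : Continuous fun t : ℝ => b + t • (z - b) := by fun_prop
    simpa using (this.tendsto 0).mono_left nhdsWithin_le_nhds
  refine le_of_tendsto hline.tendsto_slope_zero_right ?_
  filter_upwards [htendsto.eventually hρD, Ioo_mem_nhdsGT (zero_lt_one' ℝ)] with t ht ht01
  have hmem : b + t • (z - b) ∈ D := by
    rw [← hD.interior_eq]
    exact hc.add_smul_sub_mem_interior' (frontier_subset_closure hb) (by rwa [hD.interior_eq])
      ⟨ht01.1, ht01.2.le⟩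
  simpa [hρb] using mul_nonpos_of_nonneg_of_nonpos (inv_nonneg.2 ht01.1.le) (ht.1 hmem).le

lemma fderiv_definingFunction_neg (hD : IsOpen D) (hc : Convex ℝ D) {b : E}
    (hb : b ∈ frontier D) {ρ : E → ℝ} (hρ : Differentiable ℝ ρ) (hρ0 : fderiv ℝ ρ b ≠ 0)
    (hρD : ∀ᶠ y in 𝓝 b, (y ∈ D ↔ ρ y < 0)) (hz : z ∈ D) : fderiv ℝ ρ b (z - b) < 0 := by
  obtain ⟨w, hw⟩ : ∃ w, 0 < fderiv ℝ ρ b w := by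
    obtain ⟨w, hw⟩ := DFunLike.ne_iff.1 hρ0
    rcases lt_or_gt_of_ne hw with h | h
    · exact ⟨-w, by simpa using h⟩
    · exact ⟨w, h⟩
  have hpush : ∀ᶠ t in 𝓝[>] (0 : ℝ), z + t • w ∈ D := by
    have : Continuous fun t : ℝ => z + t • w := by fun_prop
    exact nhdsWithin_le_nhds ((hD.preimage this).mem_nhds (by simpa using hz))
  obtain ⟨t, hmem, ht⟩ := (hpush.and self_mem_nhdsWithin).exists
  have hle := fderiv_definingFunction_nonpos hD hc hb hρ hρD hmem
  rw [add_sub_right_comm, map_add, map_smul, smul_eq_mul] at hle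
  linarith [mul_pos ht hw]

lemma fderiv_definingFunction_pos_at_exit (hD : IsOpen D) (hc : Convex ℝ D)
    (hb : Bornology.IsBounded D) (hz : z ∈ D) (hv : v ≠ 0) {ρ : E → ℝ} (hρ : Differentiable ℝ ρ)
    (hρ0 : fderiv ℝ ρ (z + exitRadius D (z, v) • v) ≠ 0)
    (hρD : ∀ᶠ y in 𝓝 (z + exitRadius D (z, v) • v), (y ∈ D ↔ ρ y < 0)) :
    0 < fderiv ℝ ρ (z + exitRadius D (z, v) • v) v := by
  have hneg := fderiv_definingFunction_neg hD hc
    (add_exitRadius_smul_mem_frontier hD hc hb hz hv) hρ hρ0 hρD hz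
  rw [sub_add_cancel_left, map_neg, map_smul, smul_eq_mul, neg_lt_zero] at hneg
  exact (pos_iff_pos_of_mul_pos hneg).1 (exitRadius_pos hD hb hz hv)

lemma contDiffAt_exitRadius [CompleteSpace E] (hD : IsOpen D) (hc : Convex ℝ D)
    (hb : Bornology.IsBounded D) (hz : z ∈ D) (hv : v ≠ 0) {n : WithTop ℕ∞} (hn : n ≠ 0)
    {ρ : E → ℝ} (hρ : ContDiff ℝ n ρ) (hρ0 : fderiv ℝ ρ (z + exitRadius D (z, v) • v) ≠ 0)
    (hρD : ∀ᶠ y in 𝓝 (z + exitRadius D (z, v) • v), (y ∈ D ↔ ρ y < 0)) :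
    ContDiffAt ℝ n (exitRadius D) (z, v) := by
  set R := exitRadius D (z, v)
  have hρd : Differentiable ℝ ρ := hρ.differentiable hn
  let Φ : (E × E) × ℝ → ℝ := fun u => ρ (u.1.1 + u.2 • u.1.2)
  have hΦ : ContDiffAt ℝ n Φ ((z, v), R) := (hρ.comp (by fun_prop)).contDiffAt
  have hpos := fderiv_definingFunction_pos_at_exit hD hc hb hz hv hρd hρ0 hρD
  have hpartial : fderiv ℝ Φ ((z, v), R) (0, 1) = fderiv ℝ ρ (z + R • v) v := by
    have hray : HasDerivAt (fun s : ℝ => z + s • v) v R := by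
      simpa using ((hasDerivAt_id R).smul_const v).const_add z
    exact ((hΦ.differentiableAt hn).hasFDerivAt.comp_hasDerivAt R
      ((hasDerivAt_const R (z, v)).prodMk (hasDerivAt_id R))).unique
      ((hρd _).hasFDerivAt.comp_hasDerivAt R hray)
  have hinv : (fderiv ℝ Φ ((z, v), R) ∘L .inr ℝ (E × E) ℝ).IsInvertible :=
    ⟨ContinuousLinearEquiv.unitsEquivAut ℝ (Units.mk0 _ hpos.ne'), by ext; simp [hpartial, R]⟩
  have hcont := continuousAt_exitRadius hD hc hb hz hv
  have hzero := eventually_eq_zero_of_mem_frontier hD hρ.continuous hρD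
  have hexit : Tendsto (fun p : E × E => p.1 + exitRadius D p • p.2) (𝓝 (z, v))
      (𝓝 (z + R • v)) := (continuousAt_fst.add (hcont.smul continuousAt_snd)).tendsto
  have hadm : ∀ᶠ p : E × E in 𝓝 (z, v), p.1 ∈ D ∧ p.2 ≠ 0 :=
    (continuous_fst.continuousAt.eventually (hD.mem_nhds hz)).and
      (continuous_snd.continuousAt.eventually_ne hv)
  refine (hΦ.contDiffAt_implicitFunction hn hinv).congr_of_eventuallyEq ?_
  filter_upwards [(tendsto_id.prodMk_nhds hcont).eventually
    (hΦ.eventually_apply_eq_iff_implicitFunction hn hinv), hexit.eventually hzero, hadm]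
    with p himplicit hp0 hp
  refine (himplicit.1 ?_).symm
  rw [show Φ ((z, v), R) = 0 from
    hzero.self_of_nhds (add_exitRadius_smul_mem_frontier hD hc hb hz hv)]
  exact hp0 (add_exitRadius_smul_mem_frontier hD hc hb hp.1 hp.2)

end ExitRadius

/-- A bounded convex open set with smooth boundary, the domains of the theorem. -/
structure IsSmoothConvexDomain (D : Set E3) : Prop where
  isOpen : IsOpen D
  convex : Convex ℝ D
  isBounded : Bornology.IsBounded D
  hasSmoothBoundary : HasSmoothBoundary D

lemma IsSmoothConvexDomain.contDiffAt_exitRadius {D : Set E3} (hD : IsSmoothConvexDomain D)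
    {z v : E3} (hz : z ∈ D) (hv : v ≠ 0) : ContDiffAt ℝ ∞ (exitRadius D) (z, v) := by
  obtain ⟨ρ, hρ, hρ0, hρD⟩ := hD.hasSmoothBoundary _
    (add_exitRadius_smul_mem_frontier hD.isOpen hD.convex hD.isBounded hz hv)
  exact _root_.contDiffAt_exitRadius hD.isOpen hD.convex hD.isBounded hz hv (by simp) hρ hρ0 hρD

section Slicing

variable {E : Type*} [NormedAddCommGroup E] [InnerProductSpace ℝ E] [FiniteDimensional ℝ E]
  [MeasurableSpace E] [BorelSpace E] {F : Type*} [NormedAddCommGroup F] [NormedSpace ℝ F] {η : E}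

/-- The coordinates `(p, y) ↦ p η + y` on `E` adapted to the hyperplanes orthogonal to a unit
vector `η`. -/
noncomputable def sliceEquiv (hη : ‖η‖ = 1) : ℝ × (Submodule.span ℝ {η})ᗮ ≃ᵐ E :=
  (((LinearIsometryEquiv.toSpanUnitSingleton η hη).toMeasurableEquiv.prodCongr
    (MeasurableEquiv.refl _)).trans (MeasurableEquiv.toLp 2 _)).trans
      (Submodule.orthogonalDecomposition (Submodule.span ℝ {η})).symm.toMeasurableEquiv

lemma sliceEquiv_apply (hη : ‖η‖ = 1) (q : ℝ × (Submodule.span ℝ {η})ᗮ) :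
    sliceEquiv hη q = q.1 • η + (q.2 : E) :=
  rfl

lemma measurePreserving_sliceEquiv (hη : ‖η‖ = 1) : MeasurePreserving (sliceEquiv hη) :=
  (Submodule.orthogonalDecomposition (Submodule.span ℝ {η})).symm.measurePreserving.comp
    ((WithLp.volume_preserving_toLp _ _).comp
      ((LinearIsometryEquiv.toSpanUnitSingleton η hη).measurePreserving.prod
        (MeasurePreserving.id volume)))

lemma inner_sliceEquiv (hη : ‖η‖ = 1) (q : ℝ × (Submodule.span ℝ {η})ᗮ) :
    inner ℝ η (sliceEquiv hη q) = q.1 := by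
  rw [sliceEquiv_apply, inner_add_right, real_inner_smul_right, real_inner_self_eq_norm_sq, hη,
    Submodule.mem_orthogonal_singleton_iff_inner_right.1 q.2.2]
  ring

lemma integral_eq_integral_integral_slice (hη : ‖η‖ = 1) {f : E → F} (hf : Integrable f) :
    ∫ y, f y = ∫ p : ℝ, ∫ y : (Submodule.span ℝ {η})ᗮ, f (p • η + (y : E)) := by
  rw [← (measurePreserving_sliceEquiv hη).integral_comp']
  exact integral_prod _ ((measurePreserving_sliceEquiv hη).integrable_comp_of_integrable hf)

end Slicing

section Radon

variable {f : E3 → E3} {η : E3}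

lemma integrable_radon (hη : ‖η‖ = 1) (hf : Integrable f) : Integrable fun p => radon f p η :=
  ((measurePreserving_sliceEquiv hη).integrable_comp_of_integrable hf).integral_prod_left

lemma integral_inner_smul_eq_integral_radon (hη : ‖η‖ = 1) {m : ℝ → ℝ}
    (hf : Integrable fun y => m (inner ℝ η y) • f y) :
    ∫ y, m (inner ℝ η y) • f y = ∫ p, m p • radon f p η := by
  rw [integral_eq_integral_integral_slice hη hf]
  refine integral_congr_ae (Eventually.of_forall fun p => ?_)
  simp only [← sliceEquiv_apply hη (p, _), inner_sliceEquiv, integral_smul]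
  rfl

/-- The open slab of half-width `ε` about the plane `{y | ⟪η, y⟫ = p}`. -/
def slab (η : E3) (p ε : ℝ) : Set E3 :=
  {y | |inner ℝ η y - p| < ε}

lemma isOpen_slab (η : E3) (p ε : ℝ) : IsOpen (slab η p ε) :=
  isOpen_lt (by fun_prop) continuous_const

lemma setIntegral_slab (hη : ‖η‖ = 1) (hf : Integrable f) (p : ℝ) {ε : ℝ} (hε : 0 ≤ ε) :
    ∫ y in slab η p ε, f y = ∫ q in (p - ε)..(p + ε), radon f q η := by
  have hind : (slab η p ε).indicator f =
      fun y => (ball p ε).indicator (1 : ℝ → ℝ) (inner ℝ η y) • f y := by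
    ext1 y
    by_cases h : |inner ℝ η y - p| < ε <;> simp [slab, indicator, Real.dist_eq, h]
  rw [← integral_indicator (isOpen_slab η p ε).measurableSet, hind,
    integral_inner_smul_eq_integral_radon hη
      (hind ▸ hf.indicator (isOpen_slab η p ε).measurableSet),
    intervalIntegral.integral_of_le (by linarith), integral_Ioc_eq_integral_Ioo, ← Real.ball_eq_Ioo,
    ← integral_indicator measurableSet_ball]
  refine integral_congr_ae (Eventually.of_forall fun q => ?_)
  by_cases h : q ∈ ball p ε <;> simp [h]

end Radon

section ParametricIntegral

variable {F : Type*} [NormedAddCommGroup F] [NormedSpace ℝ F]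

lemma exists_bound_integral_comp {X P : Type*} [TopologicalSpace X] [TopologicalSpace P]
    {Ψ : X × P → F} {O : Set (X × P)} {L : Set X} {K : Set P} (hΨ : ContinuousOn Ψ O)
    (hL : IsCompact L) (hK : IsCompact K) (hLK : L ×ˢ K ⊆ O) :
    ∃ C, ∀ {W : Type*} [MeasurableSpace W] (μ : Measure W) [IsFiniteMeasure μ] (γ : W → P),
      (∀ w, γ w ∈ K) → ∀ t ∈ L, ‖∫ w, Ψ (t, γ w) ∂μ‖ ≤ C * μ.real univ := by
  obtain ⟨C, hC⟩ := (hL.prod hK).exists_bound_of_continuousOn (hΨ.mono hLK)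
  exact ⟨C, fun μ _ γ hγK t ht => norm_integral_le_of_norm_le_const
    (Eventually.of_forall fun w => hC _ ⟨ht, hγK w⟩)⟩

variable {P : Type*} [NormedAddCommGroup P] [NormedSpace ℝ P] {Ψ : ℝ × P → F}
  {O : Set (ℝ × P)} {J L : Set ℝ} {K : Set P}
  {W : Type*} [TopologicalSpace W] [SecondCountableTopology W] [MeasurableSpace W]
  [OpensMeasurableSpace W] {μ : Measure W} [IsFiniteMeasure μ] {γ : W → P}

lemma hasDerivAt_integral_comp (hO : IsOpen O) (hΨ : ContDiffOn ℝ 1 Ψ O) (hJ : IsOpen J)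
    (hJL : J ⊆ L) (hL : IsCompact L) (hK : IsCompact K) (hLK : L ×ˢ K ⊆ O) (hγ : Continuous γ)
    (hγK : ∀ w, γ w ∈ K) {t : ℝ} (ht : t ∈ J) :
    HasDerivAt (fun t => ∫ w, Ψ (t, γ w) ∂μ) (∫ w, fderiv ℝ Ψ (t, γ w) (1, 0) ∂μ) t := by
  have hmem {s : ℝ} (hs : s ∈ J) (w : W) : (s, γ w) ∈ O := hLK ⟨hJL hs, hγK w⟩
  have hΨ' : ContinuousOn (fun q => fderiv ℝ Ψ q (1, 0)) O :=
    (hΨ.continuousOn_fderiv_of_isOpen hO le_rfl).clm_apply continuousOn_const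
  obtain ⟨C, hC⟩ := (hL.prod hK).exists_bound_of_continuousOn (hΨ.continuousOn.mono hLK)
  obtain ⟨C', hC'⟩ := (hL.prod hK).exists_bound_of_continuousOn (hΨ'.mono hLK)
  have hmeas {G : ℝ × P → F} (hG : ContinuousOn G O) {s : ℝ} (hs : s ∈ J) :
      AEStronglyMeasurable (fun w => G (s, γ w)) μ :=
    (hG.comp_continuous (by fun_prop) (hmem hs)).aestronglyMeasurable
  have hderiv (w : W) (s : ℝ) (hs : s ∈ J) :
      HasDerivAt (fun s => Ψ (s, γ w)) (fderiv ℝ Ψ (s, γ w) (1, 0)) s :=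
    ((hΨ.contDiffAt (hO.mem_nhds (hmem hs w))).differentiableAt
      (by simp)).hasFDerivAt.comp_hasDerivAt s ((hasDerivAt_id s).prodMk (hasDerivAt_const s (γ w)))
  refine (hasDerivAt_integral_of_dominated_loc_of_deriv_le (bound := fun _ => C')
    (F' := fun t w => fderiv ℝ Ψ (t, γ w) (1, 0)) (hJ.mem_nhds ht) ?_ ?_ (hmeas hΨ' ht) ?_
    (integrable_const _) ?_).2
  · filter_upwards [hJ.mem_nhds ht] with s hs using hmeas hΨ.continuousOn hs
  · exact .of_bound (hmeas hΨ.continuousOn ht) C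
      (Eventually.of_forall fun w => hC _ ⟨hJL ht, hγK w⟩)
  · exact Eventually.of_forall fun w s hs => hC' _ ⟨hJL hs, hγK w⟩
  · exact Eventually.of_forall hderiv

lemma contDiffOn_integral_comp (hO : IsOpen O) (hΨ : ContDiffOn ℝ ∞ Ψ O) (hJ : IsOpen J)
    (hJL : J ⊆ L) (hL : IsCompact L) (hK : IsCompact K) (hLK : L ×ˢ K ⊆ O) (hγ : Continuous γ)
    (hγK : ∀ w, γ w ∈ K) : ContDiffOn ℝ ∞ (fun t => ∫ w, Ψ (t, γ w) ∂μ) J := by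
  refine contDiffOn_infty.2 fun n => ?_
  induction n generalizing Ψ with
  | zero =>
    exact contDiffOn_zero.2 fun t ht => (hasDerivAt_integral_comp hO (hΨ.of_le (by simp)) hJ hJL hL
      hK hLK hγ hγK ht).continuousAt.continuousWithinAt
  | succ n ih =>
    have hderiv (t : ℝ) (ht : t ∈ J) := hasDerivAt_integral_comp (μ := μ) hO
      (hΨ.of_le (by simp)) hJ hJL hL hK hLK hγ hγK ht
    rw [Nat.cast_succ, contDiffOn_succ_iff_deriv_of_isOpen hJ]
    refine ⟨fun t ht => (hderiv t ht).differentiableAt.differentiableWithinAt, by simp, ?_⟩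
    exact (ih ((hΨ.fderiv_of_isOpen hO (by simp)).clm_apply contDiffOn_const)).congr
      fun t ht => (hderiv t ht).deriv

lemma exists_bound_iteratedDeriv_integral_comp (hO : IsOpen O) (hΨ : ContDiffOn ℝ ∞ Ψ O)
    (hJ : IsOpen J) (hJL : J ⊆ L) (hL : IsCompact L) (hK : IsCompact K) (hLK : L ×ˢ K ⊆ O)
    (k : ℕ) :
    ∃ C, ∀ {W : Type*} [TopologicalSpace W] [SecondCountableTopology W] [MeasurableSpace W]
      [OpensMeasurableSpace W] (μ : Measure W) [IsFiniteMeasure μ] (γ : W → P), Continuous γ →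
      (∀ w, γ w ∈ K) → ∀ t ∈ J,
        ‖iteratedDeriv k (fun t => ∫ w, Ψ (t, γ w) ∂μ) t‖ ≤ C * μ.real univ := by
  induction k generalizing Ψ with
  | zero =>
    obtain ⟨C, hC⟩ := exists_bound_integral_comp hΨ.continuousOn hL hK hLK
    exact ⟨C, fun μ _ γ _ hγK t ht => by simpa using hC μ γ hγK t (hJL ht)⟩
  | succ k ih =>
    obtain ⟨C, hC⟩ := ih ((hΨ.fderiv_of_isOpen hO (by simp)).clm_apply contDiffOn_const)
    refine ⟨C, fun μ _ γ hγ hγK t ht => ?_⟩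
    have hderiv : deriv (fun t => ∫ w, Ψ (t, γ w) ∂μ) =ᶠ[𝓝 t]
        fun t => ∫ w, fderiv ℝ Ψ (t, γ w) (1, 0) ∂μ := by
      filter_upwards [hJ.mem_nhds ht] with s hs
      exact (hasDerivAt_integral_comp hO (hΨ.of_le (by simp)) hJ hJL hL hK hLK hγ hγK hs).deriv
    rw [iteratedDeriv_succ', hderiv.iteratedDeriv_eq]
    exact hC μ γ hγ hγK t ht

end ParametricIntegral

section Polar

variable {E F : Type*} [NormedAddCommGroup E] [NormedSpace ℝ E] [NormedAddCommGroup F]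
  [NormedSpace ℝ F]

lemma integral_eq_integral_toSphere [FiniteDimensional ℝ E] [Nontrivial E]
    [MeasurableSpace E] [BorelSpace E] (μ : Measure E) [μ.IsAddHaarMeasure] {f : E → F}
    (hf : Integrable f μ) :
    ∫ y, f y ∂μ = ∫ v : sphere (0 : E) 1,
      (∫ r in Ioi (0 : ℝ), r ^ (Module.finrank ℝ E - 1) • f (r • (v : E))) ∂μ.toSphere := by
  set e := (homeomorphUnitSphereProd E).toMeasurableEquiv
  have hpolar : MeasurePreserving e.symm (μ.toSphere.prod
      (.volumeIoiPow (Module.finrank ℝ E - 1))) (μ.comap ((↑) : ({0}ᶜ : Set E) → E)) :=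
    (μ.measurePreserving_homeomorphUnitSphereProd).symm e
  have hint : Integrable (fun q => f (e.symm q)) (μ.toSphere.prod
      (.volumeIoiPow (Module.finrank ℝ E - 1))) :=
    hpolar.integrable_comp_of_integrable
      (((MeasurableEmbedding.subtype_coe (measurableSet_singleton _).compl).integrable_map_iff).1
        (by rw [map_comap_subtype_coe (measurableSet_singleton _).compl]; exact hf.restrict))
  calc ∫ y, f y ∂μ = ∫ y : ({0}ᶜ : Set E), f y ∂(μ.comap (↑)) := by
        rw [integral_subtype_comap (measurableSet_singleton _).compl f, restrict_compl_singleton]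
    _ = ∫ q, f (e.symm q) ∂(μ.toSphere.prod (.volumeIoiPow (Module.finrank ℝ E - 1))) :=
        (hpolar.integral_comp' fun y : ({0}ᶜ : Set E) => f y).symm
    _ = _ := by
        rw [integral_prod _ hint]
        refine integral_congr_ae (Eventually.of_forall fun v => ?_)
        simp only [Measure.volumeIoiPow, ENNReal.ofReal]
        rw [integral_withDensity_eq_integral_smul (by fun_prop)]
        refine (integral_subtype_comap measurableSet_Ioi fun r : ℝ =>
          Real.toNNReal (r ^ (Module.finrank ℝ E - 1)) • f (r • (v : E))).trans ?_
        exact setIntegral_congr_fun measurableSet_Ioi fun r hr => by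
          simp [NNReal.smul_def, Real.coe_toNNReal _ (pow_nonneg (le_of_lt hr) _)]

variable {D : Set E} {f : E → F} {z v : E}

/-- The integrand of `∫ rⁿ f (z + r v) dr` over the part of the ray in `D`, after the substitution
`r = s * exitRadius D (z, v)`, which makes the range of integration `0 < s < 1` independent of `z`
and `v`. -/
noncomputable def rayIntegrand (D : Set E) (n : ℕ) (f : E → F) (z v : E) (s : ℝ) : F :=
  (exitRadius D (z, v) ^ (n + 1) * s ^ n) • f (z + (s * exitRadius D (z, v)) • v)

lemma integral_ray_indicator (hD : IsOpen D) (hc : Convex ℝ D) (hb : Bornology.IsBounded D)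
    (hz : z ∈ D) (hv : v ≠ 0) (n : ℕ) :
    ∫ r in Ioi (0 : ℝ), r ^ n • (closure D).indicator f (z + r • v) =
      ∫ s in (0 : ℝ)..1, rayIntegrand D n f z v s := by
  have hρ := exitRadius_pos hD hb hz hv
  set ρ := exitRadius D (z, v) with hρdef
  have hind (r : ℝ) (hr : r ∈ Ioi (0 : ℝ)) : r ^ n • (closure D).indicator f (z + r • v) =
      (Iic ρ).indicator (fun r => r ^ n • f (z + r • v)) r := by
    have := add_smul_mem_closure_iff_le_exitRadius hD hc hb hz hv (le_of_lt hr)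
    by_cases h : r ≤ ρ <;> simp [indicator, this, ← hρdef, h]
  have hsubst := intervalIntegral.smul_integral_comp_mul_right (a := 0) (b := 1)
    (fun r => r ^ n • f (z + r • v)) ρ
  rw [setIntegral_congr_fun measurableSet_Ioi hind, setIntegral_indicator measurableSet_Iic,
    Ioi_inter_Iic, ← intervalIntegral.integral_of_le hρ.le]
  rw [zero_mul, one_mul, ← intervalIntegral.integral_smul] at hsubst
  rw [← hsubst]
  refine intervalIntegral.integral_congr fun s _ => ?_
  simp only [rayIntegrand, ← hρdef, smul_smul]
  congr 1
  ring

lemma integral_submodule_indicator_eq_integral_polar {V : Submodule ℝ E} [FiniteDimensional ℝ V]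
    [Nontrivial V] [MeasurableSpace V] [BorelSpace V] (μ : Measure V) [μ.IsAddHaarMeasure]
    (hD : IsOpen D) (hc : Convex ℝ D) (hb : Bornology.IsBounded D) (hf : Continuous f)
    (hz : z ∈ D) :
    ∫ y : V, (closure D).indicator f (z + y) ∂μ = ∫ w : sphere (0 : V) 1 × unitInterval,
      rayIntegrand D (Module.finrank ℝ V - 1) f z w.1 w.2 ∂(μ.toSphere.prod volume) := by
  have hne (v : sphere (0 : V) 1) : ((v : V) : E) ≠ 0 := by
    simpa using ne_zero_of_mem_unit_sphere v
  have hK : IsCompact {y : V | z + (y : E) ∈ closure D} := by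
    refine Metric.isCompact_of_isClosed_isBounded (isClosed_closure.preimage (by fun_prop)) ?_
    obtain ⟨R, hR⟩ := hb.closure.subset_closedBall z
    refine isBounded_closedBall (x := (0 : V)) (r := R) |>.subset fun y hy => ?_
    simpa using hR hy
  have hint : Integrable (fun y : V => (closure D).indicator f (z + y)) μ :=
    ((Continuous.continuousOn (by fun_prop)).integrableOn_compact
      (f := fun y : V => f (z + y)) hK).integrable_indicator hK.measurableSet
  have hcont : Continuous fun w : sphere (0 : V) 1 × unitInterval =>
      rayIntegrand D (Module.finrank ℝ V - 1) f z w.1 w.2 := by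
    have hρ : Continuous fun w : sphere (0 : V) 1 × unitInterval =>
        exitRadius D (z, ((w.1 : V) : E)) :=
      continuous_iff_continuousAt.2 fun w => ContinuousAt.comp
        (f := fun w : sphere (0 : V) 1 × unitInterval => (z, ((w.1 : V) : E)))
        (continuousAt_exitRadius hD hc hb hz (hne w.1)) (by fun_prop)
    unfold rayIntegrand
    fun_prop
  rw [integral_eq_integral_toSphere μ hint,
    integral_prod _ (hcont.integrable_of_hasCompactSupport (HasCompactSupport.of_compactSpace _))]
  refine integral_congr_ae (Eventually.of_forall fun v => ?_)
  refine (integral_ray_indicator hD hc hb hz (hne v) _).trans ?_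
  rw [intervalIntegral.integral_of_le zero_le_one, ← integral_Icc_eq_integral_Ioc]
  exact (integral_subtype_comap measurableSet_Icc _).symm

end Polar

section RadonRegularity

instance fact_finrank_E3 : Fact (Module.finrank ℝ E3 = 2 + 1) :=
  ⟨by simp⟩

variable {D : Set E3} {F : E3 → E3} {x η : E3}

lemma finrank_orthogonal_span (hη : ‖η‖ = 1) : Module.finrank ℝ (Submodule.span ℝ {η})ᗮ = 2 :=
  Submodule.finrank_orthogonal_span_singleton (norm_pos_iff.1 (hη ▸ one_pos))

lemma measureReal_circle_prod_unitInterval (hη : ‖η‖ = 1) :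
    ((volume : Measure (Submodule.span ℝ {η})ᗮ).toSphere.prod
      (volume : Measure unitInterval)).real univ = 2 * Real.pi := by
  have hdim := finrank_orthogonal_span hη
  have : Nontrivial (Submodule.span ℝ {η})ᗮ := Module.nontrivial_of_finrank_pos (R := ℝ) (by omega)
  rw [← univ_prod_univ, measureReal_prod_prod,
    probReal_univ (μ := (volume : Measure unitInterval)), mul_one,
    Measure.toSphere_real_apply_univ, hdim, measureReal_def,
    InnerProductSpace.volume_ball_of_dim_even (k := 1) (by omega)]
  simp [Real.pi_nonneg]

lemma radon_inner (hη : ‖η‖ = 1) (f : E3 → E3) (z : E3) :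
    radon f (inner ℝ η z) η = ∫ y : (Submodule.span ℝ {η})ᗮ, f (z + y) := by
  have hperp : z - inner ℝ η z • η ∈ (Submodule.span ℝ {η})ᗮ := by
    rw [Submodule.mem_orthogonal_singleton_iff_inner_right, inner_sub_right, real_inner_smul_right,
      real_inner_self_eq_norm_sq, hη]
    ring
  rw [radon, ← integral_add_left_eq_self _ (⟨_, hperp⟩ : (Submodule.span ℝ {η})ᗮ)]
  simp only [Submodule.coe_add, ← add_assoc, add_sub_cancel]

lemma radon_eq_integral_polar (hD : IsSmoothConvexDomain D) (hF : Continuous F) (hη : ‖η‖ = 1)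
    {t : ℝ} (ht : x + t • η ∈ D) :
    radon ((closure D).indicator F) (inner ℝ η x + t) η =
      ∫ w : sphere (0 : (Submodule.span ℝ {η})ᗮ) 1 × unitInterval,
        rayIntegrand D 1 F (x + t • η) w.1 w.2 ∂((volume : Measure _).toSphere.prod volume) := by
  have hdim := finrank_orthogonal_span hη
  have : Nontrivial (Submodule.span ℝ {η})ᗮ := Module.nontrivial_of_finrank_pos (R := ℝ) (by omega)
  have hinner : inner ℝ η x + t = inner ℝ η (x + t • η) := by
    rw [inner_add_right, real_inner_smul_right, real_inner_self_eq_norm_sq, hη]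
    ring
  rw [hinner, radon_inner hη, integral_submodule_indicator_eq_integral_polar volume hD.isOpen
    hD.convex hD.isBounded hF ht, hdim]

lemma contDiffOn_rayIntegrand (hD : IsSmoothConvexDomain D) (hF : ContDiff ℝ ∞ F) (x : E3) :
    ContDiffOn ℝ ∞ (fun q : ℝ × E3 × E3 × ℝ =>
      rayIntegrand D 1 F (x + q.1 • q.2.1) q.2.2.1 q.2.2.2)
      {q | x + q.1 • q.2.1 ∈ D ∧ q.2.2.1 ≠ 0} := fun q hq => by
  have hρ : ContDiffAt ℝ ∞ (fun q : ℝ × E3 × E3 × ℝ =>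
      exitRadius D (x + q.1 • q.2.1, q.2.2.1)) q :=
    ContDiffAt.comp (f := fun q : ℝ × E3 × E3 × ℝ => (x + q.1 • q.2.1, q.2.2.1)) q
      (hD.contDiffAt_exitRadius hq.1 hq.2) (by fun_prop)
  refine ContDiffAt.contDiffWithinAt
    (((hρ.pow _).mul (by fun_prop)).smul (hF.contDiffAt.comp q ?_))
  fun_prop

/-- Smoothness near `p = ⟪η, x⟫` of the Radon transform of `f`, with bounds on its derivatives that
are uniform in the direction `η`. -/
structure IsRadonRegularAt (f : E3 → E3) (x : E3) (δ : ℝ) : Prop where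
  pos : 0 < δ
  contDiffOn (η : S2) : ContDiffOn ℝ ∞ (fun p => radon f p η) (ball (inner ℝ (η : E3) x) δ)
  exists_bound (k : ℕ) : ∃ C, ∀ η : S2, ∀ p ∈ ball (inner ℝ (η : E3) x) δ,
    ‖iteratedDeriv k (fun p => radon f p η) p‖ ≤ C

lemma exists_closedBall_prod_subset_rayDomain (hD : IsOpen D) (hx : x ∈ D) :
    ∃ δ > 0, closedBall (0 : ℝ) δ ×ˢ (sphere (0 : E3) 1 ×ˢ sphere (0 : E3) 1 ×ˢ Icc (0 : ℝ) 1) ⊆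
      {q | x + q.1 • q.2.1 ∈ D ∧ q.2.2.1 ≠ 0} := by
  obtain ⟨δ, hδ, hball⟩ := nhds_basis_closedBall.mem_iff.1 (hD.mem_nhds hx)
  refine ⟨δ, hδ, fun q ⟨ht, hη, hv, _⟩ => ⟨hball ?_, ne_zero_of_mem_unit_sphere ⟨_, hv⟩⟩⟩
  simpa [norm_smul, mem_sphere_zero_iff_norm.1 hη] using ht

lemma IsSmoothConvexDomain.exists_isRadonRegularAt (hD : IsSmoothConvexDomain D)
    (hF : ContDiff ℝ ∞ F) (hx : x ∈ D) :
    ∃ δ, IsRadonRegularAt ((closure D).indicator F) x δ := by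
  obtain ⟨δ, hδ, hLK⟩ := exists_closedBall_prod_subset_rayDomain hD.isOpen hx
  set O := {q : ℝ × E3 × E3 × ℝ | x + q.1 • q.2.1 ∈ D ∧ q.2.2.1 ≠ 0}
  set K : Set (E3 × E3 × ℝ) := sphere 0 1 ×ˢ sphere 0 1 ×ˢ Icc 0 1
  have hO : IsOpen O := (hD.isOpen.preimage (by fun_prop)).inter (isOpen_ne.preimage (by fun_prop))
  have hK : IsCompact K := (isCompact_sphere _ _).prod ((isCompact_sphere _ _).prod isCompact_Icc)
  have hline (η : S2) {t : ℝ} (ht : t ∈ closedBall 0 δ) : x + t • (η : E3) ∈ D :=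
    (hLK (a := (t, η, η, 0)) ⟨ht, η.2, η.2, by simp⟩).1
  have hΨ := contDiffOn_rayIntegrand hD hF x
  set Ψ := fun q : ℝ × E3 × E3 × ℝ => rayIntegrand D 1 F (x + q.1 • q.2.1) q.2.2.1 q.2.2.2
  let μ (η : S2) := (volume : Measure (Submodule.span ℝ {(η : E3)})ᗮ).toSphere.prod
    (volume : Measure unitInterval)
  let γ (η : S2) (w : sphere (0 : (Submodule.span ℝ {(η : E3)})ᗮ) 1 × unitInterval) :
      E3 × E3 × ℝ := (η, w.1, w.2)
  have hγ (η : S2) : Continuous (γ η) := by fun_prop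
  have hγK (η : S2) (w) : γ η w ∈ K :=
    ⟨η.2, mem_sphere_zero_iff_norm.2 (mem_sphere_zero_iff_norm.1 w.1.2 :), w.2.2⟩
  have hpolar (η : S2) : EqOn (fun p => radon ((closure D).indicator F) p η)
      (fun p => ∫ w, Ψ (p - inner ℝ (η : E3) x, γ η w) ∂μ η) (ball (inner ℝ (η : E3) x) δ) :=
    fun p hp => by
      simpa using radon_eq_integral_polar hD hF.continuous (norm_eq_of_mem_sphere η)
        (hline η (t := p - inner ℝ (η : E3) x)
          (ball_subset_closedBall (by simpa [dist_eq_norm] using hp)))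
  refine ⟨δ, hδ, fun η => ?_, fun k => ?_⟩
  · exact ((contDiffOn_integral_comp hO hΨ isOpen_ball ball_subset_closedBall
      (isCompact_closedBall _ _) hK hLK (hγ η) (hγK η)).comp (by fun_prop) fun p hp => by
        simpa [dist_eq_norm] using hp).congr (hpolar η)
  · obtain ⟨C, hC⟩ := exists_bound_iteratedDeriv_integral_comp hO hΨ isOpen_ball
      ball_subset_closedBall (isCompact_closedBall _ _) hK hLK k
    refine ⟨C * (2 * Real.pi), fun η p hp => ?_⟩
    have hμ := measureReal_circle_prod_unitInterval (norm_eq_of_mem_sphere η)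
    rw [((hpolar η).eventuallyEq_of_mem (isOpen_ball.mem_nhds hp)).iteratedDeriv_eq,
      iteratedDeriv_comp_sub_const k (fun t => ∫ w, Ψ (t, γ η w) ∂μ η), ← hμ]
    exact hC (μ η) (γ η) (hγ η) (hγK η) _ (by simpa [dist_eq_norm] using hp)

end RadonRegularity

section OneVariable

variable {F : Type*} [NormedAddCommGroup F] [NormedSpace ℝ F] {r : ℝ → F} {a δ C : ℝ}

lemma hasDerivAt_iteratedDeriv {J : Set ℝ} (hJ : IsOpen J) (hr : ContDiffOn ℝ ∞ r J) (k : ℕ)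
    {p : ℝ} (hp : p ∈ J) : HasDerivAt (iteratedDeriv k r) (iteratedDeriv (k + 1) r p) p := by
  rw [iteratedDeriv_succ]
  have hdiff : DifferentiableOn ℝ (iteratedDerivWithin k r J) J :=
    hr.differentiableOn_iteratedDerivWithin
      (by exact_mod_cast WithTop.coe_lt_coe.2 (ENat.natCast_lt_top k)) hJ.uniqueDiffOn
  refine ((hdiff.differentiableAt (hJ.mem_nhds hp)).congr_of_eventuallyEq ?_).hasDerivAt
  filter_upwards [hJ.mem_nhds hp] with q hq using (iteratedDerivWithin_of_isOpen hJ hq).symm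

lemma norm_le_mul_pow_succ_of_hasDerivAt {e e' : ℝ → F} {k : ℕ} (hC : 0 ≤ C) (h0 : e 0 = 0)
    (hderiv : ∀ t, |t| < δ → HasDerivAt e (e' t) t) (hbound : ∀ t, |t| < δ → ‖e' t‖ ≤ C * |t| ^ k)
    {t : ℝ} (ht : |t| < δ) : ‖e t‖ ≤ C * |t| ^ (k + 1) := by
  have hseg {s : ℝ} (hs : s ∈ uIcc 0 t) : |s| ≤ |t| := by simpa using abs_sub_left_of_mem_uIcc hs
  have h := (convex_uIcc 0 t).norm_image_sub_le_of_norm_hasDerivWithin_le (C := C * |t| ^ k)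
    (fun s hs => (hderiv s ((hseg hs).trans_lt ht)).hasDerivWithinAt)
    (fun s hs => (hbound s ((hseg hs).trans_lt ht)).trans (by gcongr C * ?_ ^ k; exact hseg hs))
    left_mem_uIcc right_mem_uIcc
  rwa [h0, sub_zero, sub_zero, Real.norm_eq_abs, mul_assoc, ← pow_succ] at h

lemma norm_sub_taylor_two_le (hr : ContDiffOn ℝ ∞ r (ball a δ))
    (hbound : ∀ p ∈ ball a δ, ‖iteratedDeriv 3 r p‖ ≤ C) {t : ℝ} (ht : |t| < δ) :
    ‖r (a + t) - r a - t • iteratedDeriv 1 r a - (t ^ 2 / 2) • iteratedDeriv 2 r a‖ ≤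
      C * |t| ^ 3 := by
  have hmem {s : ℝ} (hs : |s| < δ) : a + s ∈ ball a δ := by simpa using hs
  have hC : 0 ≤ C := (norm_nonneg _).trans (hbound _ (hmem ht))
  have hderiv (k : ℕ) (s : ℝ) (hs : |s| < δ) : HasDerivAt (fun s => iteratedDeriv k r (a + s))
      (iteratedDeriv (k + 1) r (a + s)) s :=
    (hasDerivAt_iteratedDeriv isOpen_ball hr k (hmem hs)).comp_const_add a s
  have hsecond (s : ℝ) (hs : |s| < δ) :
      ‖iteratedDeriv 2 r (a + s) - iteratedDeriv 2 r a‖ ≤ C * |s| ^ 1 :=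
    norm_le_mul_pow_succ_of_hasDerivAt (k := 0) hC (by simp)
      (fun s hs => (hderiv 2 s hs).sub_const _)
      (fun s hs => by simpa using hbound _ (hmem hs)) hs
  have hfirst (s : ℝ) (hs : |s| < δ) :
      ‖iteratedDeriv 1 r (a + s) - iteratedDeriv 1 r a - s • iteratedDeriv 2 r a‖ ≤ C * |s| ^ 2 :=
    norm_le_mul_pow_succ_of_hasDerivAt (e := fun s => iteratedDeriv 1 r (a + s) -
        iteratedDeriv 1 r a - s • iteratedDeriv 2 r a) hC (by simp)
      (fun s hs => ((hderiv 1 s hs).sub_const _).fun_sub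
        (by simpa using (hasDerivAt_id s).smul_const (iteratedDeriv 2 r a))) hsecond hs
  refine norm_le_mul_pow_succ_of_hasDerivAt (e := fun t => r (a + t) - r a -
    t • iteratedDeriv 1 r a - (t ^ 2 / 2) • iteratedDeriv 2 r a) hC (by simp)
    (fun s hs => ?_) hfirst ht
  have hlin := (hasDerivAt_id s).smul_const (iteratedDeriv 1 r a)
  have hquad := (((hasDerivAt_id s).pow 2).div_const 2).smul_const (iteratedDeriv 2 r a)
  simpa using (((hderiv 0 s hs).sub_const (r a)).fun_sub hlin).fun_sub hquad

/-- The second-order difference of integrals over concentric intervals, half the integral of `r`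
over `(a - 2ε, a + 2ε)` minus that over `(a - ε, a + ε)`, in which the value and the first
derivative of `r` at `a` cancel. -/
noncomputable def intervalDifference (r : ℝ → F) (a ε : ℝ) : F :=
  (2⁻¹ : ℝ) • (∫ q in (a - 2 * ε)..(a + 2 * ε), r q) - ∫ q in (a - ε)..(a + ε), r q

lemma intervalDifference_eq_integral {ε : ℝ}
    (h₂ : IntervalIntegrable (fun t => r (a + 2 * t)) volume (-ε) ε)
    (h₁ : IntervalIntegrable (fun t => r (a + 1 * t)) volume (-ε) ε) :
    intervalDifference r a ε = ∫ t in (-ε)..ε, (r (a + 2 * t) - r (a + 1 * t)) := by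
  rw [intervalIntegral.integral_sub h₂ h₁, intervalDifference,
    intervalIntegral.integral_comp_add_mul _ two_ne_zero,
    intervalIntegral.integral_comp_add_mul _ one_ne_zero]
  simp only [mul_neg, inv_one, one_smul, one_mul, ← sub_eq_add_neg]

lemma norm_intervalDifference_sub_le [CompleteSpace F] (hr : ContDiffOn ℝ ∞ r (ball a δ))
    (hbound : ∀ p ∈ ball a δ, ‖iteratedDeriv 3 r p‖ ≤ C) {ε : ℝ} (hε : 0 ≤ ε) (hεδ : 2 * ε < δ) :
    ‖intervalDifference r a ε - ε ^ 3 • iteratedDeriv 2 r a‖ ≤ 18 * C * ε ^ 4 := by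
  have hsmall {t : ℝ} (ht : |t| ≤ ε) : |t| < δ ∧ |2 * t| < δ := by
    rw [abs_mul, abs_two]
    constructor <;> linarith
  have hint {c : ℝ} (hc : ∀ t, |t| ≤ ε → |c * t| < δ) :
      IntervalIntegrable (fun t => r (a + c * t)) volume (-ε) ε := by
    refine (hr.continuousOn.comp (by fun_prop) fun t ht => ?_).intervalIntegrable
    rw [uIcc_of_le (by linarith)] at ht
    simpa using hc t (abs_le.2 ht)
  have hint₂ := hint fun t ht => (hsmall ht).2
  have hint₁ := hint (c := 1) fun t ht => by simpa using (hsmall ht).1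
  have hmain : ε ^ 3 • iteratedDeriv 2 r a =
      ∫ t in (-ε)..ε, (t • iteratedDeriv 1 r a + (3 / 2 * t ^ 2) • iteratedDeriv 2 r a) := by
    rw [intervalIntegral.integral_add (Continuous.intervalIntegrable (by fun_prop) _ _)
      (Continuous.intervalIntegrable (by fun_prop) _ _), intervalIntegral.integral_smul_const,
      intervalIntegral.integral_smul_const, intervalIntegral.integral_const_mul, integral_pow,
      integral_id]
    module
  rw [intervalDifference_eq_integral hint₂ hint₁, hmain,
    ← intervalIntegral.integral_sub (hint₂.sub hint₁)
      (Continuous.intervalIntegrable (by fun_prop) _ _)]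
  refine (intervalIntegral.norm_integral_le_of_norm_le_const (C := 9 * C * ε ^ 3)
    fun t ht => ?_).trans (le_of_eq ?_)
  · have ht' : |t| ≤ ε := abs_le.2 (Ioc_subset_Icc_self (uIoc_of_le (by linarith : -ε ≤ ε) ▸ ht))
    have hC : 0 ≤ C := (norm_nonneg _).trans (hbound a (mem_ball_self (by linarith)))
    calc _ = ‖(r (a + 2 * t) - r a - (2 * t) • iteratedDeriv 1 r a -
            ((2 * t) ^ 2 / 2) • iteratedDeriv 2 r a) -
          (r (a + t) - r a - t • iteratedDeriv 1 r a - (t ^ 2 / 2) • iteratedDeriv 2 r a)‖ := by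
            rw [one_mul]
            congr 1
            module
      _ ≤ C * |2 * t| ^ 3 + C * |t| ^ 3 :=
          norm_sub_le_of_le (norm_sub_taylor_two_le hr hbound (hsmall ht').2)
            (norm_sub_taylor_two_le hr hbound (hsmall ht').1)
      _ = 9 * C * |t| ^ 3 := by rw [abs_mul, abs_two]; ring
      _ ≤ 9 * C * ε ^ 3 := by gcongr
  · rw [abs_of_nonneg (by linarith)]
    ring

lemma stronglyMeasurable_iteratedDeriv {W : Type*} [MeasurableSpace W] {g : W → ℝ → F}
    {J : Set ℝ} (hJ : IsOpen J) (hg : ∀ w, ContDiffOn ℝ ∞ (g w) J)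
    (hmeas : ∀ t ∈ J, StronglyMeasurable fun w => g w t) (k : ℕ) {t : ℝ} (ht : t ∈ J) :
    StronglyMeasurable fun w => iteratedDeriv k (g w) t := by
  induction k generalizing t with
  | zero => simpa using hmeas t ht
  | succ k ih =>
    have hnear : ∀ᶠ s in 𝓝[≠] t, s ∈ J := mem_nhdsWithin_of_mem_nhds (hJ.mem_nhds ht)
    obtain ⟨u, hu, huJ⟩ := exists_seq_forall_of_frequently hnear.frequently
    refine stronglyMeasurable_of_tendsto atTop
      (f := fun n w => slope (iteratedDeriv k (g w)) t (u n)) (fun n => ?_)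
      (tendsto_pi_nhds.2 fun w =>
        (hasDerivAt_iteratedDeriv hJ (hg w) k ht).tendsto_slope.comp hu)
    exact ((ih (huJ n)).sub (ih ht)).const_smul _

end OneVariable

section RadonMeasurability

instance isFiniteMeasure_surfaceMeasure : IsFiniteMeasure surfaceMeasure := by
  unfold surfaceMeasure
  infer_instance

variable {f : E3 → E3} {x : E3} {δ : ℝ}

lemma stronglyMeasurable_setIntegral_slab (hf : StronglyMeasurable f) {p : S2 → ℝ}
    (hp : Continuous p) (ε : ℝ) :
    StronglyMeasurable fun η : S2 => ∫ y in slab η (p η) ε, f y := by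
  have hslab : MeasurableSet {q : S2 × E3 | |inner ℝ (q.1 : E3) q.2 - p q.1| < ε} :=
    (isOpen_lt (by fun_prop) continuous_const).measurableSet
  simp_rw [← integral_indicator (isOpen_slab _ _ _).measurableSet]
  exact StronglyMeasurable.integral_prod_right
    (f := fun (η : S2) y => (slab (η : E3) (p η) ε).indicator f y)
    ((hf.comp_measurable measurable_snd).indicator hslab)

lemma tendsto_average_slab {η : E3} (hη : ‖η‖ = 1) (hf : Integrable f) {p : ℝ}
    (hp : ContinuousAt (fun p => radon f p η) p) :
    Tendsto (fun h : ℝ => h⁻¹ • ∫ y in slab η (p + h / 2) (h / 2), f y) (𝓝[>] 0)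
      (𝓝 (radon f p η)) := by
  have hint := integrable_radon hη hf
  refine ((intervalIntegral.integral_hasDerivAt_right (a := p) hint.intervalIntegrable
    hint.aestronglyMeasurable.stronglyMeasurableAtFilter
    hp).tendsto_slope_zero_right).congr' ?_
  filter_upwards [self_mem_nhdsWithin] with h hh
  rw [setIntegral_slab hη hf _ (half_pos hh).le, intervalIntegral.integral_same, sub_zero]
  congr 2 <;> ring

lemma stronglyMeasurable_radon (hf : StronglyMeasurable f) (hfi : Integrable f) {p : S2 → ℝ}
    (hp : Continuous p) (hcont : ∀ η : S2, ContinuousAt (fun p => radon f p η) (p η)) :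
    StronglyMeasurable fun η : S2 => radon f (p η) η :=
  stronglyMeasurable_of_tendsto (𝓝[>] (0 : ℝ))
    (fun h => (stronglyMeasurable_setIntegral_slab hf (by fun_prop) _).const_smul h⁻¹)
    (tendsto_pi_nhds.2 fun η => tendsto_average_slab (norm_eq_of_mem_sphere η) hfi (hcont η))

lemma dist_inner_le {E : Type*} [NormedAddCommGroup E] [InnerProductSpace ℝ E]
    (η : sphere (0 : E) 1) (x y : E) :
    dist (inner ℝ (η : E) x) (inner ℝ (η : E) y) ≤ dist x y := by
  rw [dist_eq_norm, ← inner_sub_right, dist_eq_norm]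
  simpa using norm_inner_le_norm (𝕜 := ℝ) (η : E) (x - y)

lemma IsRadonRegularAt.of_mem_ball (h : IsRadonRegularAt f x δ) {y : E3} (hy : y ∈ ball x δ) :
    IsRadonRegularAt f y (δ - dist y x) := by
  have hsub (η : S2) : ball (inner ℝ (η : E3) y) (δ - dist y x) ⊆ ball (inner ℝ (η : E3) x) δ :=
    ball_subset_ball' (by linarith [dist_inner_le η y x])
  refine ⟨sub_pos.2 hy, fun η => (h.contDiffOn η).mono (hsub η), fun k => ?_⟩
  obtain ⟨C, hC⟩ := h.exists_bound k
  exact ⟨C, fun η p hp => hC η p (hsub η hp)⟩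

lemma IsRadonRegularAt.stronglyMeasurable_iteratedDeriv (h : IsRadonRegularAt f x δ)
    (hf : StronglyMeasurable f) (hfi : Integrable f) (k : ℕ) :
    StronglyMeasurable fun η : S2 =>
      iteratedDeriv k (fun p => radon f p η) (inner ℝ (η : E3) x) := by
  have hmem (η : S2) {t : ℝ} (ht : t ∈ ball 0 δ) :
      inner ℝ (η : E3) x + t ∈ ball (inner ℝ (η : E3) x) δ := by simpa using ht
  have hshift := _root_.stronglyMeasurable_iteratedDeriv isOpen_ball (F := E3) (J := ball 0 δ)
    (g := fun (η : S2) t => radon f (inner ℝ (η : E3) x + t) η)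
    (fun η => (h.contDiffOn η).comp (by fun_prop) fun t ht => hmem η ht)
    (fun t ht => stronglyMeasurable_radon hf hfi (by fun_prop) fun η =>
      (h.contDiffOn η).continuousOn.continuousAt (isOpen_ball.mem_nhds (hmem η ht)))
    k (mem_ball_self h.pos)
  refine (congrArg StronglyMeasurable (funext fun η => ?_)).mp hshift
  simp only [iteratedDeriv_comp_const_add k (fun p => radon f p η), add_zero]

lemma IsRadonRegularAt.integrable_iteratedDeriv (h : IsRadonRegularAt f x δ)
    (hf : StronglyMeasurable f) (hfi : Integrable f) (k : ℕ) :
    Integrable (fun η : S2 => iteratedDeriv k (fun p => radon f p η) (inner ℝ (η : E3) x))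
      surfaceMeasure := by
  obtain ⟨C, hC⟩ := h.exists_bound k
  exact .of_bound (h.stronglyMeasurable_iteratedDeriv hf hfi k).aestronglyMeasurable C
    (Eventually.of_forall fun η => hC η _ (mem_ball_self h.pos))

end RadonMeasurability

section Archimedes

lemma volume_annulus_of_finrank_eq_two {V : Type*} [NormedAddCommGroup V] [InnerProductSpace ℝ V]
    [FiniteDimensional ℝ V] [MeasurableSpace V] [BorelSpace V] (hV : Module.finrank ℝ V = 2)
    {a b : ℝ} (ha : 0 ≤ a) :
    volume {y : V | a < ‖y‖ ^ 2 ∧ ‖y‖ ^ 2 < b} = ENNReal.ofReal (Real.pi * (b - a)) := by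
  have : Nontrivial V := Module.nontrivial_of_finrank_pos (R := ℝ) (by omega)
  rcases le_or_gt b a with hba | hab
  · rw [ENNReal.ofReal_of_nonpos (mul_nonpos_of_nonneg_of_nonpos Real.pi_nonneg (by linarith))]
    convert measure_empty (μ := (volume : Measure V))
    exact eq_empty_of_forall_notMem fun y hy => (hy.1.trans hy.2).not_ge hba
  have hset : {y : V | a < ‖y‖ ^ 2 ∧ ‖y‖ ^ 2 < b} = ball 0 √b \ closedBall 0 √a := by
    ext y
    rw [Set.mem_sdiff, mem_ball_zero_iff, mem_closedBall_zero_iff, not_le,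
      Real.lt_sqrt (norm_nonneg y), Real.sqrt_lt ha (norm_nonneg y), and_comm, mem_ofPred_eq]
  have hsub : closedBall (0 : V) √a ⊆ ball 0 √b :=
    closedBall_subset_ball (Real.sqrt_lt_sqrt ha hab)
  rw [hset, measure_sdiff hsub isClosed_closedBall.measurableSet.nullMeasurableSet
    measure_closedBall_lt_top.ne, InnerProductSpace.volume_ball_of_dim_even (k := 1) (by omega),
    InnerProductSpace.volume_closedBall_of_dim_even (k := 1) (by omega), hV,
    ← ENNReal.ofReal_pow (Real.sqrt_nonneg _), ← ENNReal.ofReal_pow (Real.sqrt_nonneg _),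
    Real.sq_sqrt ha, Real.sq_sqrt (ha.trans hab.le), ← ENNReal.ofReal_mul (ha.trans hab.le),
    ← ENNReal.ofReal_mul ha, ← ENNReal.ofReal_sub _ (by positivity)]
  congr 1
  simp only [pow_one, Nat.factorial_one, Nat.cast_one, div_one]
  ring

lemma lintegral_ofReal_one_sub_div_sq {s : ℝ} (hs : 0 < s) :
    ∫⁻ p : ℝ, ENNReal.ofReal (1 - (p / s) ^ 2) = ENNReal.ofReal (4 * s / 3) := by
  have hnonneg {p : ℝ} : p ∈ Icc (-s) s ↔ 0 ≤ 1 - (p / s) ^ 2 := by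
    rw [sub_nonneg, sq_le_one_iff_abs_le_one, abs_div, abs_of_pos hs, div_le_one hs, abs_le,
      mem_Icc]
  have hsupp : Function.support (fun p => ENNReal.ofReal (1 - (p / s) ^ 2)) ⊆ Icc (-s) s :=
    fun p hp => hnonneg.2 (ENNReal.ofReal_pos.1 (pos_iff_ne_zero.2 hp)).le
  rw [← setLIntegral_eq_of_support_subset hsupp, ← ofReal_integral_eq_lintegral_ofReal
      (Continuous.integrableOn_Icc (by fun_prop))
      (ae_restrict_of_forall_mem measurableSet_Icc fun p hp => hnonneg.1 hp),
    integral_Icc_eq_integral_Ioc, ← intervalIntegral.integral_of_le (by linarith),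
    intervalIntegral.integral_comp_div (fun p => 1 - p ^ 2) hs.ne']
  congr 1
  rw [intervalIntegral.integral_sub (by simp) (Continuous.intervalIntegrable (by fun_prop) _ _),
    integral_pow, neg_div, div_self hs.ne']
  norm_num
  ring

lemma sliceEquiv_mem_cone_iff {E : Type*} [NormedAddCommGroup E] [InnerProductSpace ℝ E]
    [FiniteDimensional ℝ E] [MeasurableSpace E] [BorelSpace E] {η : E} (hη : ‖η‖ = 1) {s : ℝ}
    (hs : 0 < s) (q : ℝ × (Submodule.span ℝ {η})ᗮ) :
    ‖sliceEquiv hη q‖ < 1 ∧ |inner ℝ η (sliceEquiv hη q)| < s * ‖sliceEquiv hη q‖ ↔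
      (1 / s ^ 2 - 1) * q.1 ^ 2 < ‖q.2‖ ^ 2 ∧ ‖q.2‖ ^ 2 < 1 - q.1 ^ 2 := by
  have hnorm : ‖sliceEquiv hη q‖ ^ 2 = q.1 ^ 2 + ‖q.2‖ ^ 2 := by
    rw [sliceEquiv_apply, norm_add_sq_real, norm_smul, hη, real_inner_smul_left,
      Submodule.mem_orthogonal_singleton_iff_inner_right.1 q.2.2, Real.norm_eq_abs, mul_one, sq_abs,
      Submodule.coe_norm]
    ring
  rw [inner_sliceEquiv, and_comm, ← sq_lt_one_iff₀ (norm_nonneg _),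
    ← abs_of_nonneg (mul_nonneg hs.le (norm_nonneg (sliceEquiv hη q))), ← sq_lt_sq, mul_pow, hnorm,
    ← lt_sub_iff_add_lt', ← div_lt_iff₀' (by positivity : 0 < s ^ 2), ← sub_lt_iff_lt_add']
  ring_nf

lemma volume_cone {η : E3} (hη : ‖η‖ = 1) {s : ℝ} (hs : 0 < s) (hs1 : s ≤ 1) :
    volume {y : E3 | ‖y‖ < 1 ∧ |inner ℝ η y| < s * ‖y‖} = ENNReal.ofReal (4 * Real.pi * s / 3) := by
  have hmeas : MeasurableSet {y : E3 | ‖y‖ < 1 ∧ |inner ℝ η y| < s * ‖y‖} := by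
    refine ((isOpen_lt ?_ ?_).and (isOpen_lt ?_ ?_)).measurableSet <;> fun_prop
  have hs2 : 0 ≤ 1 / s ^ 2 - 1 :=
    sub_nonneg.2 (one_le_one_div (by positivity) (pow_le_one₀ hs.le hs1))
  have hslice (p : ℝ) : volume (Prod.mk p ⁻¹' (sliceEquiv hη ⁻¹'
      {y : E3 | ‖y‖ < 1 ∧ |inner ℝ η y| < s * ‖y‖})) =
        ENNReal.ofReal Real.pi * ENNReal.ofReal (1 - (p / s) ^ 2) := by
    simp only [preimage_ofPred_eq, sliceEquiv_mem_cone_iff hη hs]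
    rw [volume_annulus_of_finrank_eq_two (finrank_orthogonal_span hη)
      (mul_nonneg hs2 (sq_nonneg p)), ← ENNReal.ofReal_mul Real.pi_nonneg]
    ring_nf
  rw [← (measurePreserving_sliceEquiv hη).measure_preimage_equiv, Measure.volume_eq_prod,
    Measure.prod_apply ((sliceEquiv hη).measurable hmeas), lintegral_congr hslice,
    lintegral_const_mul' _ _ ENNReal.ofReal_ne_top, lintegral_ofReal_one_sub_div_sq hs,
    ← ENNReal.ofReal_mul Real.pi_nonneg]
  ring_nf

open scoped Pointwise in
lemma Ioo_smul_zone {E : Type*} [NormedAddCommGroup E] [InnerProductSpace ℝ E] (w : E) {ε : ℝ} :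
    Ioo (0 : ℝ) 1 • ((↑) '' {η : sphere (0 : E) 1 | |inner ℝ (η : E) w| < ε}) =
      {y : E | ‖y‖ < 1 ∧ |inner ℝ w y| < ε * ‖y‖} := by
  ext y
  constructor
  · rintro ⟨r, hr, _, ⟨η, hη, rfl⟩, rfl⟩
    have hnorm : ‖r • (η : E)‖ = r := by simp [norm_smul, abs_of_pos hr.1]
    refine ⟨hnorm.trans_lt hr.2, ?_⟩
    rw [hnorm, real_inner_smul_right, abs_mul, abs_of_pos hr.1, mul_comm ε, real_inner_comm]
    exact mul_lt_mul_of_pos_left hη hr.1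
  · rintro ⟨hy1, hyw⟩
    have hy : y ≠ 0 := by
      rintro rfl
      simp at hyw
    have hy0 : 0 < ‖y‖ := norm_pos_iff.2 hy
    refine ⟨‖y‖, ⟨hy0, hy1⟩, _, ⟨⟨‖y‖⁻¹ • y, ?_⟩, ?_, rfl⟩, smul_inv_smul₀ hy0.ne' y⟩
    · simp [norm_smul, hy]
    · rw [mem_ofPred_eq, real_inner_smul_left, abs_mul, abs_of_pos (inv_pos.2 hy0),
        inv_mul_lt_iff₀ hy0, mul_comm, real_inner_comm]
      exact hyw

lemma surfaceMeasure_real_univ : surfaceMeasure.real univ = 4 * Real.pi := by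
  rw [surfaceMeasure, Measure.toSphere_real_apply_univ, measureReal_def,
    EuclideanSpace.volume_ball_fin_three, finrank_euclideanSpace_fin, ENNReal.ofReal_one, one_pow,
    one_mul, ENNReal.toReal_ofReal (by positivity)]
  push_cast
  ring

lemma surfaceMeasure_real_zone {w : E3} (hw : w ≠ 0) {ε : ℝ} (hε : 0 < ε) :
    surfaceMeasure.real {η : S2 | |inner ℝ (η : E3) w| < ε} = 4 * Real.pi * min 1 (ε / ‖w‖) := by
  have hw0 : 0 < ‖w‖ := norm_pos_iff.2 hw
  rcases le_or_gt (ε / ‖w‖) 1 with hle | hlt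
  · have hmeas : MeasurableSet {η : S2 | |inner ℝ (η : E3) w| < ε} :=
      (isOpen_lt (by fun_prop) continuous_const).measurableSet
    have hunit (y : E3) : |inner ℝ w y| < ε * ‖y‖ ↔
        |inner ℝ (‖w‖⁻¹ • w) y| < ε / ‖w‖ * ‖y‖ := by
      rw [real_inner_smul_left, abs_mul, abs_of_pos (inv_pos.2 hw0), inv_mul_eq_div,
        div_mul_eq_mul_div, div_lt_div_iff_of_pos_right hw0]
    have hnorm : ‖‖w‖⁻¹ • w‖ = 1 := by simpa using norm_smul_inv_norm (𝕜 := ℝ) hw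
    rw [measureReal_def, surfaceMeasure, Measure.toSphere_apply' _ hmeas, Ioo_smul_zone]
    simp only [hunit]
    rw [volume_cone hnorm (by positivity) hle,
      finrank_euclideanSpace_fin, ENNReal.toReal_mul, ENNReal.toReal_ofReal (by positivity),
      min_eq_right hle, ENNReal.toReal_natCast]
    push_cast
    ring
  · have huniv : {η : S2 | |inner ℝ (η : E3) w| < ε} = univ := eq_univ_of_forall fun η =>
      (abs_real_inner_le_norm _ _).trans_lt
        (by rwa [norm_eq_of_mem_sphere, one_mul, ← one_lt_div hw0])
    rw [huniv, surfaceMeasure_real_univ, min_eq_left hlt.le, mul_one]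

end Archimedes

section AveragedKernel

/-- The step function whose integral against a translate and dilate of a function `r` is
`intervalDifference r`. -/
noncomputable def differenceWindow (t : ℝ) : ℝ :=
  2⁻¹ * (Ioo (-2) 2).indicator 1 t - (Ioo (-1) 1).indicator 1 t

/-- The average of `differenceWindow ⟪η, v⟫` over all directions `η`, times `4π`, as a function of
`‖v‖`; at `v = 0` the convention `1 / 0 = 0` makes it vanish instead. -/
noncomputable def averagedKernel (ρ : ℝ) : ℝ :=
  4 * Real.pi * (2⁻¹ * min 1 (2 / ρ) - min 1 (1 / ρ))

lemma measurable_differenceWindow : Measurable differenceWindow :=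
  ((measurable_one.indicator measurableSet_Ioo).const_mul _).sub
    (measurable_one.indicator measurableSet_Ioo)

lemma abs_differenceWindow_le_one (t : ℝ) : |differenceWindow t| ≤ 1 := by
  by_cases h2 : t ∈ Ioo (-2 : ℝ) 2 <;> by_cases h1 : t ∈ Ioo (-1 : ℝ) 1 <;>
    norm_num [differenceWindow, h1, h2]

lemma integral_differenceWindow_smul {F : Type*} [NormedAddCommGroup F] [NormedSpace ℝ F]
    {r : ℝ → F} (hr : Integrable r) (a : ℝ) {ε : ℝ} (hε : 0 < ε) :
    ∫ p, differenceWindow ((p - a) / ε) • r p = intervalDifference r a ε := by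
  have hmem (c p : ℝ) : (Ioo (-c) c).indicator (1 : ℝ → ℝ) ((p - a) / ε) • r p =
      (Ioo (a - c * ε) (a + c * ε)).indicator r p := by
    have hiff : (p - a) / ε ∈ Ioo (-c) c ↔ p ∈ Ioo (a - c * ε) (a + c * ε) := by
      rw [mem_Ioo, mem_Ioo, lt_div_iff₀ hε, div_lt_iff₀ hε]
      constructor <;> rintro ⟨h1, h2⟩ <;> constructor <;> linarith
    by_cases hp : p ∈ Ioo (a - c * ε) (a + c * ε) <;> simp [hp, hiff]
  have hint {c : ℝ} (hc : 0 ≤ c) :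
      ∫ p, (Ioo (a - c) (a + c)).indicator r p = ∫ p in (a - c)..(a + c), r p := by
    rw [integral_indicator measurableSet_Ioo, ← integral_Ioc_eq_integral_Ioo,
      intervalIntegral.integral_of_le (by linarith)]
  have hhalf (s : Set ℝ) (hs : MeasurableSet s) :
      Integrable fun p => (2⁻¹ : ℝ) • s.indicator r p := (hr.indicator hs).smul _
  simp only [differenceWindow, sub_smul, mul_smul, hmem]
  rw [integral_sub (hhalf _ measurableSet_Ioo) (hr.indicator measurableSet_Ioo), integral_smul,
    hint (by positivity), hint (by positivity), one_mul, intervalDifference]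

lemma integral_differenceWindow_inner {w : E3} (hw : w ≠ 0) :
    ∫ η : S2, differenceWindow (inner ℝ (η : E3) w) ∂surfaceMeasure = averagedKernel ‖w‖ := by
  have hmeas (c : ℝ) : MeasurableSet {η : S2 | |inner ℝ (η : E3) w| < c} :=
    (isOpen_lt (by fun_prop) continuous_const).measurableSet
  have hzone (c : ℝ) (η : S2) : (Ioo (-c) c).indicator (1 : ℝ → ℝ) (inner ℝ (η : E3) w) =
      {η : S2 | |inner ℝ (η : E3) w| < c}.indicator 1 η := by
    simp only [indicator_apply, mem_Ioo, mem_ofPred_eq, abs_lt, Pi.one_apply]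
  have hint (c : ℝ) : Integrable ({η : S2 | |inner ℝ (η : E3) w| < c}.indicator (1 : S2 → ℝ))
      surfaceMeasure := (integrable_const (1 : ℝ)).indicator (hmeas c)
  simp only [differenceWindow, hzone]
  rw [integral_sub ((hint 2).const_mul _) (hint 1), integral_const_mul,
    integral_indicator_one (hmeas 2), integral_indicator_one (hmeas 1),
    surfaceMeasure_real_zone hw two_pos, surfaceMeasure_real_zone hw one_pos, averagedKernel]
  ring

lemma integral_integral_differenceWindow_smul {F : Type*} [NormedAddCommGroup F] [NormedSpace ℝ F]
    [CompleteSpace F] {g : E3 → F} (hg : Integrable g) :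
    ∫ η : S2, (∫ v, differenceWindow (inner ℝ (η : E3) v) • g v) ∂surfaceMeasure =
      ∫ v, averagedKernel ‖v‖ • g v := by
  have hwindow : AEStronglyMeasurable
      (fun q : S2 × E3 => differenceWindow (inner ℝ (q.1 : E3) q.2))
      (surfaceMeasure.prod volume) :=
    (measurable_differenceWindow.comp (by fun_prop)).aestronglyMeasurable
  rw [integral_integral_swap ((hg.comp_snd surfaceMeasure).bdd_smul (φ := fun q : S2 × E3 =>
    differenceWindow (inner ℝ (q.1 : E3) q.2)) 1 hwindow (Eventually.of_forall fun q =>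
      abs_differenceWindow_le_one _))]
  refine integral_congr_ae ?_
  filter_upwards [compl_mem_ae_iff.2 (measure_singleton (0 : E3))] with v hv
  rw [integral_smul_const, integral_differenceWindow_inner hv]

lemma averagedKernel_of_le_one {ρ : ℝ} (h0 : 0 < ρ) (h1 : ρ ≤ 1) :
    averagedKernel ρ = -(2 * Real.pi) := by
  rw [averagedKernel, min_eq_left ((one_le_div h0).2 (by linarith)),
    min_eq_left ((one_le_div h0).2 h1)]
  ring

lemma averagedKernel_of_mem_Icc {ρ : ℝ} (hρ : ρ ∈ Icc 1 2) :
    averagedKernel ρ = 2 * Real.pi - 4 * Real.pi / ρ := by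
  have h0 : 0 < ρ := one_pos.trans_le hρ.1
  rw [averagedKernel, min_eq_left ((one_le_div h0).2 hρ.2), min_eq_right ((div_le_one h0).2 hρ.1)]
  ring

lemma averagedKernel_of_two_le {ρ : ℝ} (h : 2 ≤ ρ) : averagedKernel ρ = 0 := by
  rw [averagedKernel, min_eq_right ((div_le_one (by linarith)).2 h),
    min_eq_right ((div_le_one (by linarith)).2 (by linarith))]
  ring

lemma measurable_averagedKernel : Measurable averagedKernel := by
  unfold averagedKernel
  fun_prop

lemma abs_averagedKernel_le {ρ : ℝ} (hρ : 0 ≤ ρ) : |averagedKernel ρ| ≤ 4 * Real.pi := by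
  have hmem (c : ℝ) (hc : 0 ≤ c) : min 1 (c / ρ) ∈ Icc (0 : ℝ) 1 :=
    ⟨le_min zero_le_one (by positivity), min_le_left _ _⟩
  rw [averagedKernel, abs_mul, abs_of_pos (by positivity : 0 < 4 * Real.pi)]
  refine mul_le_of_le_one_right (by positivity) (abs_le.2 ?_)
  have h2 := hmem 2 zero_le_two
  have h1 := hmem 1 zero_le_one
  constructor <;> linarith [h1.1, h1.2, h2.1, h2.2]

lemma integrable_averagedKernel_norm : Integrable fun v : E3 => averagedKernel ‖v‖ := by
  have hsupp : Function.support (fun v : E3 => averagedKernel ‖v‖) ⊆ ball 0 2 := fun v hv => by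
    by_contra h
    exact hv (averagedKernel_of_two_le (by simpa using h))
  refine (integrableOn_iff_integrable_of_support_subset hsupp).1 ?_
  exact Measure.integrableOn_of_bounded measure_ball_lt_top.ne
    (measurable_averagedKernel.comp measurable_norm).aestronglyMeasurable
    (Eventually.of_forall fun v => abs_averagedKernel_le (norm_nonneg v))

lemma integral_sq_mul_averagedKernel :
    ∫ ρ in Ioi (0 : ℝ), ρ ^ 2 * averagedKernel ρ = -(2 * Real.pi) := by
  have h01 : EqOn (fun ρ => ρ ^ 2 * averagedKernel ρ) (fun ρ => -(2 * Real.pi) * ρ ^ 2)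
      (Ioc 0 1) := fun ρ hρ => by
    simp only [averagedKernel_of_le_one hρ.1 hρ.2]
    ring
  have h12 : EqOn (fun ρ => ρ ^ 2 * averagedKernel ρ)
      (fun ρ => 2 * Real.pi * ρ ^ 2 - 4 * Real.pi * ρ) (Ioc 1 2) := fun ρ hρ => by
    have h0 : ρ ≠ 0 := by linarith [hρ.1]
    simp only [averagedKernel_of_mem_Icc (Ioc_subset_Icc_self hρ)]
    field_simp
  have hint {m : ℝ → ℝ} (hm : Continuous m) (a b : ℝ) : IntegrableOn m (Ioc a b) :=
    hm.integrableOn_Icc.mono_set Ioc_subset_Icc_self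
  have htail : ∫ ρ in Ioi (0 : ℝ), ρ ^ 2 * averagedKernel ρ =
      ∫ ρ in Ioc (0 : ℝ) 2, ρ ^ 2 * averagedKernel ρ :=
    setIntegral_eq_of_subset_of_forall_sdiff_eq_zero measurableSet_Ioi Ioc_subset_Ioi_self
      fun ρ hρ => by
        rw [averagedKernel_of_two_le (not_lt.1 fun h => hρ.2 ⟨hρ.1, h.le⟩), mul_zero]
  rw [htail, ← Ioc_union_Ioc_eq_Ioc zero_le_one one_le_two,
    setIntegral_union (Ioc_disjoint_Ioc_of_le le_rfl) measurableSet_Ioc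
      ((integrableOn_congr_fun h01 measurableSet_Ioc).2 (hint (by fun_prop) _ _))
      ((integrableOn_congr_fun h12 measurableSet_Ioc).2 (hint (by fun_prop) _ _)),
    setIntegral_congr_fun measurableSet_Ioc h01, setIntegral_congr_fun measurableSet_Ioc h12,
    integral_sub (hint (by fun_prop) _ _) (hint (by fun_prop) _ _), integral_const_mul,
    integral_const_mul, integral_const_mul]
  simp only [← intervalIntegral.integral_of_le zero_le_one,
    ← intervalIntegral.integral_of_le one_le_two, integral_pow, integral_id]
  norm_num
  ring

lemma integral_averagedKernel_norm : ∫ v : E3, averagedKernel ‖v‖ = -(8 * Real.pi ^ 2) := by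
  rw [integral_fun_norm_addHaar, measureReal_def, EuclideanSpace.volume_ball_fin_three,
    ENNReal.ofReal_one, one_pow, one_mul, ENNReal.toReal_ofReal (by positivity),
    finrank_euclideanSpace_fin]
  simp only [Nat.add_one_sub_one, smul_eq_mul, integral_sq_mul_averagedKernel, nsmul_eq_mul]
  push_cast
  ring

end AveragedKernel

section Inversion

lemma tendsto_integral_smul_comp_add_smul {E F : Type*} [NormedAddCommGroup E] [NormedSpace ℝ E]
    [MeasurableSpace E] [BorelSpace E] [NormedAddCommGroup F] [NormedSpace ℝ F]
    [CompleteSpace F] {μ : Measure E}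
    {K : E → ℝ} (hK : Integrable K μ) {g : E → F} (hg : StronglyMeasurable g) {M : ℝ}
    (hM : ∀ y, ‖g y‖ ≤ M) {x : E} (hx : ContinuousAt g x) :
    Tendsto (fun ε : ℝ => ∫ v, K v • g (x + ε • v) ∂μ) (𝓝[>] 0) (𝓝 ((∫ v, K v ∂μ) • g x)) := by
  rw [← integral_smul_const]
  refine tendsto_integral_filter_of_dominated_convergence (fun v => ‖K v‖ * M)
    (Eventually.of_forall fun ε => hK.aestronglyMeasurable.smul
      (hg.comp_measurable (by fun_prop)).aestronglyMeasurable)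
    (Eventually.of_forall fun ε => Eventually.of_forall fun v => ?_) (hK.norm.mul_const M)
    (Eventually.of_forall fun v => ?_)
  · rw [norm_smul]
    gcongr
    exact hM _
  · have hlim : Tendsto (fun ε : ℝ => x + ε • v) (𝓝[>] 0) (𝓝 x) :=
      ((by fun_prop : Continuous fun ε : ℝ => x + ε • v).tendsto' 0 x (by simp)).mono_left
        nhdsWithin_le_nhds
    exact (hx.tendsto.comp hlim).const_smul _

variable {f : E3 → E3} {x : E3} {δ : ℝ}

lemma integral_differenceWindow_smul_comp {η : E3} (hη : ‖η‖ = 1) (hf : Integrable f) (x : E3)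
    {ε : ℝ} (hε : 0 < ε) :
    ∫ v, differenceWindow (inner ℝ η v) • f (x + ε • v) =
      (ε ^ 3)⁻¹ • intervalDifference (fun p => radon f p η) (inner ℝ η x) ε := by
  set g : E3 → E3 := fun y => differenceWindow ((inner ℝ η y - inner ℝ η x) / ε) • f y with hgdef
  have hwindow : Measurable fun y => differenceWindow ((inner ℝ η y - inner ℝ η x) / ε) :=
    measurable_differenceWindow.comp (by fun_prop)
  have hg : Integrable g := hf.bdd_smul 1 hwindow.aestronglyMeasurable
    (Eventually.of_forall fun y => abs_differenceWindow_le_one _)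
  have hcomp (v : E3) : differenceWindow (inner ℝ η v) • f (x + ε • v) = g (x + ε • v) := by
    simp only [hgdef, inner_add_right, real_inner_smul_right, add_sub_cancel_left,
      mul_div_cancel_left₀ _ hε.ne']
  simp only [hcomp]
  rw [Measure.integral_comp_smul volume (fun w => g (x + w)), integral_add_left_eq_self g x,
    finrank_euclideanSpace_fin, abs_of_pos (by positivity),
    integral_inner_smul_eq_integral_radon hη
      (m := fun p => differenceWindow ((p - inner ℝ η x) / ε)) hg,
    integral_differenceWindow_smul (integrable_radon hη hf) _ hε]

lemma IsRadonRegularAt.tendsto_integral_differenceWindow (h : IsRadonRegularAt f x δ)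
    (hf : StronglyMeasurable f) (hfi : Integrable f) :
    Tendsto (fun ε : ℝ => ∫ η : S2, (∫ v, differenceWindow (inner ℝ (η : E3) v) • f (x + ε • v))
        ∂surfaceMeasure) (𝓝[>] 0)
      (𝓝 (∫ η : S2, iteratedDeriv 2 (fun p => radon f p η) (inner ℝ (η : E3) x)
        ∂surfaceMeasure)) := by
  obtain ⟨C, hC⟩ := h.exists_bound 3
  have hdist {ε : ℝ} (hε : ε ∈ Ioo 0 (δ / 2)) (η : S2) :
      ‖(∫ v, differenceWindow (inner ℝ (η : E3) v) • f (x + ε • v)) -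
        iteratedDeriv 2 (fun p => radon f p η) (inner ℝ (η : E3) x)‖ ≤ 18 * C * ε := by
    have hε3 : 0 < ε ^ 3 := pow_pos hε.1 3
    have hle := norm_intervalDifference_sub_le (h.contDiffOn η) (hC η) hε.1.le (by linarith [hε.2])
    rw [integral_differenceWindow_smul_comp (norm_eq_of_mem_sphere η) hfi x hε.1,
      ← inv_smul_smul₀ hε3.ne' (iteratedDeriv 2 _ _), ← smul_sub, norm_smul, norm_inv,
      Real.norm_of_nonneg hε3.le, inv_mul_le_iff₀ hε3]
    linarith
  have hmeas (ε : ℝ) : StronglyMeasurable fun η : S2 =>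
      ∫ v, differenceWindow (inner ℝ (η : E3) v) • f (x + ε • v) :=
    StronglyMeasurable.integral_prod_right
      (f := fun (η : S2) v => differenceWindow (inner ℝ (η : E3) v) • f (x + ε • v))
      ((measurable_differenceWindow.comp (by fun_prop)).stronglyMeasurable.smul
        (hf.comp_measurable (by fun_prop)))
  obtain ⟨C₂, hC₂⟩ := h.exists_bound 2
  have hsmall : ∀ᶠ ε in 𝓝[>] (0 : ℝ), ε ∈ Ioo 0 (δ / 2) := Ioo_mem_nhdsGT (half_pos h.pos)
  refine tendsto_integral_filter_of_dominated_convergence (fun _ => C₂ + 18 * |C| * (δ / 2))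
    (Eventually.of_forall fun ε => (hmeas ε).aestronglyMeasurable)
    (hsmall.mono fun ε hε => Eventually.of_forall fun η => ?_) (integrable_const _)
    (Eventually.of_forall fun η => tendsto_iff_norm_sub_tendsto_zero.2 ?_)
  · refine (norm_le_norm_add_norm_sub' _ _).trans
      (add_le_add (hC₂ η _ (mem_ball_self h.pos)) ((hdist hε η).trans ?_))
    gcongr 18 * ?_ * ?_
    exacts [hε.1.le, le_abs_self C, hε.2.le]
  · exact squeeze_zero' (Eventually.of_forall fun _ => norm_nonneg _)
      (hsmall.mono fun ε hε => hdist hε η)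
      ((((continuous_const_mul (18 * C)).tendsto' 0 0 (by simp)).mono_left nhdsWithin_le_nhds))

theorem IsRadonRegularAt.integral_iteratedDeriv_two (h : IsRadonRegularAt f x δ)
    (hf : StronglyMeasurable f) (hfi : Integrable f) {M : ℝ} (hM : ∀ y, ‖f y‖ ≤ M)
    (hx : ContinuousAt f x) :
    ∫ η : S2, iteratedDeriv 2 (fun p => radon f p η) (inner ℝ (η : E3) x) ∂surfaceMeasure =
      (-(8 * Real.pi ^ 2)) • f x := by
  have hlim := tendsto_integral_smul_comp_add_smul integrable_averagedKernel_norm hf hM hx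
  rw [integral_averagedKernel_norm] at hlim
  refine tendsto_nhds_unique (h.tendsto_integral_differenceWindow hf hfi) (hlim.congr' ?_)
  filter_upwards [self_mem_nhdsWithin] with ε hε
  exact (integral_integral_differenceWindow_smul
    ((hfi.comp_add_left x).comp_smul (ne_of_gt hε))).symm

end Inversion

section VectorCalculus

variable {F G : E3 → E3} {u : E3 → ℝ} {x : E3}

lemma divergence_eq_trace (F : E3 → E3) (x : E3) :
    divergence F x = LinearMap.trace ℝ E3 (fderiv ℝ F x : E3 →ₗ[ℝ] E3) := by
  rw [LinearMap.trace_eq_sum_inner _ (EuclideanSpace.basisFun (Fin 3) ℝ)]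
  simp [divergence, partialDeriv, EuclideanSpace.inner_single_left]

lemma differentiableAt_gradient (hu : ContDiffAt ℝ 2 u x) :
    DifferentiableAt ℝ (gradient u) x := by
  have h : DifferentiableAt ℝ (fderiv ℝ u) x :=
    (hu.fderiv_right (m := 1) (by norm_num)).differentiableAt (by norm_num)
  exact (InnerProductSpace.toDual ℝ E3).symm.toContinuousLinearEquiv.differentiableAt.comp x h

lemma partialDeriv_gradient (hu : ContDiffAt ℝ 2 u x) (i j : Fin 3) :
    partialDeriv i j (gradient u) x = fderiv ℝ (fderiv ℝ u) x (EuclideanSpace.single i 1)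
      (EuclideanSpace.single j 1) := by
  have h : DifferentiableAt ℝ (fderiv ℝ u) x :=
    (hu.fderiv_right (m := 1) (by norm_num)).differentiableAt (by norm_num)
  have hd := (InnerProductSpace.toDual ℝ E3).symm.toContinuousLinearEquiv.hasFDerivAt.comp x
    h.hasFDerivAt
  have happly (ℓ : E3 →L[ℝ] ℝ) :
      (InnerProductSpace.toDual ℝ E3).symm ℓ j = ℓ (EuclideanSpace.single j 1) := by
    rw [← InnerProductSpace.toDual_symm_apply (𝕜 := ℝ), EuclideanSpace.inner_single_right]
    simp
  exact (congrArg (fun T : E3 →L[ℝ] E3 => T (EuclideanSpace.single i 1) j) hd.fderiv).trans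
    (happly _)

lemma divergence_gradient (hu : ContDiffAt ℝ 2 u x) :
    divergence (gradient u) x = Laplacian.laplacian u x := by
  rw [InnerProductSpace.laplacian_eq_iteratedFDeriv_orthonormalBasis u
    (EuclideanSpace.basisFun (Fin 3) ℝ)]
  exact Finset.sum_congr rfl fun i _ => by
    simp [partialDeriv_gradient hu, iteratedFDeriv_two_apply]

lemma partialDeriv_of_eventuallyEq_add (h : G =ᶠ[𝓝 x] fun y => F y + gradient u y)
    (hF : DifferentiableAt ℝ F x) (hu : ContDiffAt ℝ 2 u x) (i j : Fin 3) :
    partialDeriv i j G x = partialDeriv i j F x + partialDeriv i j (gradient u) x := by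
  simp only [partialDeriv, h.fderiv_eq, fderiv_fun_add hF (differentiableAt_gradient hu)]
  rfl

lemma divergence_eq_add_laplacian (h : G =ᶠ[𝓝 x] fun y => F y + gradient u y)
    (hF : DifferentiableAt ℝ F x) (hu : ContDiffAt ℝ 2 u x) :
    divergence G x = divergence F x + Laplacian.laplacian u x := by
  simp only [← divergence_gradient hu, divergence, partialDeriv_of_eventuallyEq_add h hF hu,
    Finset.sum_add_distrib]

lemma curl_eq_of_eventuallyEq_add_gradient (h : G =ᶠ[𝓝 x] fun y => F y + gradient u y)
    (hF : DifferentiableAt ℝ F x) (hu : ContDiffAt ℝ 2 u x) : curl G x = curl F x := by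
  have hsymm (i j : Fin 3) : partialDeriv i j (gradient u) x = partialDeriv j i (gradient u) x := by
    rw [partialDeriv_gradient hu, partialDeriv_gradient hu]
    exact (hu.isSymmSndFDerivAt (by simp)).eq _ _
  simp only [curl, partialDeriv_of_eventuallyEq_add h hF hu, hsymm 1 2, hsymm 2 0, hsymm 0 1,
    add_sub_add_right_eq_sub]

end VectorCalculus

section Backprojection

variable {G : Type*} [NormedAddCommGroup G] [NormedSpace ℝ G] {f : E3 → E3} {x : E3} {δ : ℝ}

/-- The weighted backprojection `x ↦ ∫ c η (∂ₚᵏ R f (⟪η, x⟫, η)) dη`. With values of `c` in linear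
maps, one definition covers the inversion formula, its tangential part, and their derivatives. -/
noncomputable def backprojection (f : E3 → E3) (c : S2 → E3 →L[ℝ] G) (k : ℕ) (x : E3) : G :=
  ∫ η : S2, c η (iteratedDeriv k (fun p => radon f p η) (inner ℝ (η : E3) x)) ∂surfaceMeasure

/-- The weight `v ↦ ⟪η, ·⟫ • c η v` of the derivative of the backprojection with weight `c`: each
plane wave `x ↦ r ⟪η, x⟫` varies only in the direction `η`. -/
noncomputable def derivWeight (c : S2 → E3 →L[ℝ] G) (η : S2) : E3 →L[ℝ] E3 →L[ℝ] G :=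
  ContinuousLinearMap.smulRightL ℝ E3 G (innerSL ℝ (η : E3)) ∘L c η

@[simp]
lemma derivWeight_apply_apply (c : S2 → E3 →L[ℝ] G) (η : S2) (v w : E3) :
    derivWeight c η v w = inner ℝ (η : E3) w • c η v := by
  simp [derivWeight]

lemma continuous_derivWeight {c : S2 → E3 →L[ℝ] G} (hc : Continuous c) :
    Continuous (derivWeight c) := by
  unfold derivWeight
  fun_prop

namespace IsRadonRegularAt

variable (h : IsRadonRegularAt f x δ) (hf : StronglyMeasurable f) (hfi : Integrable f)

include h hf hfi

lemma integrable_backprojection {c : S2 → E3 →L[ℝ] G} (hc : Continuous c) (k : ℕ) :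
    Integrable (fun η : S2 =>
      c η (iteratedDeriv k (fun p => radon f p η) (inner ℝ (η : E3) x))) surfaceMeasure := by
  obtain ⟨B, hB⟩ := isCompact_univ.exists_bound_of_continuousOn hc.continuousOn
  have hint := h.integrable_iteratedDeriv hf hfi k
  refine (hint.norm.const_mul B).mono' ?_ (Eventually.of_forall fun η => ?_)
  · exact (ContinuousLinearMap.id ℝ (E3 →L[ℝ] G)).aestronglyMeasurable_comp₂
      hc.aestronglyMeasurable hint.aestronglyMeasurable
  · exact (c η).le_of_opNorm_le (hB η trivial) _

lemma hasFDerivAt_backprojection {c : S2 → E3 →L[ℝ] G} (hc : Continuous c) (k : ℕ) :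
    HasFDerivAt (backprojection f c k) (backprojection f (derivWeight c) (k + 1) x) x := by
  obtain ⟨C, hC⟩ := h.exists_bound (k + 1)
  have hc' := continuous_derivWeight hc
  obtain ⟨B, hB⟩ := isCompact_univ.exists_bound_of_continuousOn (E := E3 →L[ℝ] E3 →L[ℝ] G)
    hc'.continuousOn
  refine hasFDerivAt_integral_of_dominated_of_fderiv_le (bound := fun _ => B * C)
    (F' := fun y η => derivWeight c η
      (iteratedDeriv (k + 1) (fun p => radon f p η) (inner ℝ (η : E3) y)))
    (ball_mem_nhds x h.pos) ?_ (h.integrable_backprojection hf hfi hc k)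
    (h.integrable_backprojection hf hfi hc' (k + 1)).aestronglyMeasurable
    (Eventually.of_forall fun η y hy => ?_) (integrable_const _)
    (Eventually.of_forall fun η y hy => ?_)
  · filter_upwards [ball_mem_nhds x h.pos] with y hy
    exact ((h.of_mem_ball hy).integrable_backprojection hf hfi hc k).aestronglyMeasurable
  · exact (derivWeight c η).le_of_opNorm_le_of_le (hB η trivial)
      (hC η _ ((dist_inner_le η y x).trans_lt hy))
  · have hd := (hasDerivAt_iteratedDeriv isOpen_ball (h.contDiffOn η) k
      ((dist_inner_le η y x).trans_lt hy)).hasFDerivAt.comp y (innerSL ℝ (η : E3)).hasFDerivAt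
    refine ((c η).hasFDerivAt.comp y hd).congr_fderiv ?_
    ext w
    simp

lemma contDiffOn_backprojection (n : ℕ) {c : S2 → E3 →L[ℝ] G} (hc : Continuous c) (k : ℕ) :
    ContDiffOn ℝ n (backprojection f c k) (ball x δ) := by
  induction n generalizing G k with
  | zero =>
    exact contDiffOn_zero.2 fun y hy =>
      ((h.of_mem_ball hy).hasFDerivAt_backprojection hf hfi hc k).continuousAt.continuousWithinAt
  | succ n ih =>
    have hderiv (y : E3) (hy : y ∈ ball x δ) :=
      (h.of_mem_ball hy).hasFDerivAt_backprojection hf hfi hc k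
    rw [Nat.cast_succ, contDiffOn_succ_iff_fderiv_of_isOpen isOpen_ball]
    exact ⟨fun y hy => (hderiv y hy).differentiableAt.differentiableWithinAt, by simp,
      (ih (continuous_derivWeight hc) (k + 1)).congr fun y hy => (hderiv y hy).fderiv⟩

end IsRadonRegularAt

end Backprojection

section FirstPart

/-- The rank one map `v ↦ ⟪η, v⟫ • η`, which takes `radon` to `radonNor`. -/
noncomputable def normalWeight (η : S2) : E3 →L[ℝ] E3 :=
  (innerSL ℝ (η : E3)).smulRight (η : E3)

/-- The orthogonal projection along `η`, which takes `radon` to `radonTan`. -/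
noncomputable def tangentWeight (η : S2) : E3 →L[ℝ] E3 :=
  ContinuousLinearMap.id ℝ E3 - normalWeight η

/-- The potential of the normal part of the inversion formula: since `∂ₚ²⟪η, R f⟫ η` is the gradient
of the plane wave with profile `∂ₚ⟪η, R f⟫`, one derivative less is backprojected. -/
noncomputable def normalPotential (f : E3 → E3) : E3 → ℝ :=
  (1 / (8 * Real.pi ^ 2)) • backprojection f (fun η => innerSL ℝ (η : E3)) 1

lemma continuous_normalWeight : Continuous normalWeight := by
  have hL : Continuous fun η : S2 =>
      ContinuousLinearMap.smulRightL ℝ E3 E3 (innerSL ℝ (η : E3)) η := by fun_prop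
  exact hL

lemma continuous_tangentWeight : Continuous tangentWeight :=
  continuous_const.sub continuous_normalWeight

lemma inner_tangentWeight (η : S2) (v : E3) : inner ℝ (η : E3) (tangentWeight η v) = 0 := by
  simp [tangentWeight, normalWeight, inner_sub_right, inner_smul_right]

namespace IsRadonRegularAt

variable {f : E3 → E3} {x : E3} {δ : ℝ} (h : IsRadonRegularAt f x δ)

include h

lemma contDiffAt_radon (η : S2) :
    ContDiffAt ℝ ∞ (fun p => radon f p η) (inner ℝ (η : E3) x) :=
  (h.contDiffOn η).contDiffAt (ball_mem_nhds _ h.pos)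

lemma contDiffAt_radonTan (η : S2) :
    ContDiffAt ℝ ∞ (fun p => radonTan f p η) (inner ℝ (η : E3) x) :=
  (tangentWeight η).contDiff.contDiffAt.comp _ (h.contDiffAt_radon η)

lemma radonTanSecond_eq (η : S2) : radonTanSecond f x η =
    tangentWeight η (iteratedDeriv 2 (fun p => radon f p η) (inner ℝ (η : E3) x)) :=
  congrArg (fun T => T fun _ => 1)
    ((tangentWeight η).iteratedFDeriv_comp_left (h.contDiffAt_radon η) (i := 2) ENat.LEInfty.out)

lemma firstPart_eq_smul_backprojection :
    firstPart f x = (-(1 / (8 * Real.pi ^ 2))) • backprojection f tangentWeight 2 x := by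
  simp only [firstPart, backprojection, h.radonTanSecond_eq]

variable (hf : StronglyMeasurable f) (hfi : Integrable f)

include hf hfi

lemma integrable_radonTanSecond : Integrable (radonTanSecond f x) surfaceMeasure := by
  simpa only [← h.radonTanSecond_eq] using
    h.integrable_backprojection hf hfi continuous_tangentWeight 2

lemma trace_backprojection_derivWeight {c : S2 → E3 →L[ℝ] E3} (hc : Continuous c) (k : ℕ) :
    LinearMap.trace ℝ E3 (backprojection f (derivWeight c) k x).toLinearMap =
      backprojection f (fun η => innerSL ℝ (η : E3) ∘L c η) k x :=
  ((LinearMap.trace ℝ E3 ∘ₗ ContinuousLinearMap.coeLM ℝ).toContinuousLinearMap.integral_comp_comm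
    (h.integrable_backprojection hf hfi (continuous_derivWeight hc) k)).symm.trans
    (integral_congr_ae (Eventually.of_forall fun η =>
      LinearMap.trace_smulRight (R := ℝ) (M := E3) (innerSL ℝ (η : E3)).toLinearMap _))

lemma gradient_backprojection_inner (k : ℕ) :
    gradient (backprojection f (fun η => innerSL ℝ (η : E3)) k) x =
      backprojection f normalWeight (k + 1) x := by
  have hc : Continuous fun η : S2 => innerSL ℝ (η : E3) := by fun_prop
  have hcomm := (InnerProductSpace.toDual ℝ E3).symm.toContinuousLinearEquiv.toContinuousLinearMap
    |>.integral_comp_comm (h.integrable_backprojection hf hfi (continuous_derivWeight hc) (k + 1))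
  rw [gradient, (h.hasFDerivAt_backprojection hf hfi hc k).fderiv]
  refine hcomm.symm.trans (integral_congr_ae (Eventually.of_forall fun η => ?_))
  refine (InnerProductSpace.toDual ℝ E3).symm_apply_eq.2 (ContinuousLinearMap.ext fun w => ?_)
  simp [normalWeight, mul_comm]

lemma contDiffOn_normalPotential (n : ℕ) : ContDiffOn ℝ n (normalPotential f) (ball x δ) :=
  (h.contDiffOn_backprojection hf hfi n (c := fun η => innerSL ℝ (η : E3)) (by fun_prop)
    1).const_smul (1 / (8 * Real.pi ^ 2))

lemma gradient_normalPotential : gradient (normalPotential f) x =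
    (1 / (8 * Real.pi ^ 2)) • backprojection f normalWeight 2 x := by
  have hd := (h.hasFDerivAt_backprojection hf hfi (c := fun η => innerSL ℝ (η : E3))
    (by fun_prop) 1).differentiableAt
  rw [← h.gradient_backprojection_inner hf hfi 1, normalPotential, gradient, fderiv_const_smul hd]
  simp [gradient]

lemma hasFDerivAt_firstPart : HasFDerivAt (firstPart f)
    ((-(1 / (8 * Real.pi ^ 2))) • backprojection f (derivWeight tangentWeight) 3 x) x := by
  refine ((h.hasFDerivAt_backprojection hf hfi continuous_tangentWeight 2).const_smul
    (-(1 / (8 * Real.pi ^ 2)))).congr_of_eventuallyEq ?_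
  filter_upwards [ball_mem_nhds x h.pos] with y hy
  exact (h.of_mem_ball hy).firstPart_eq_smul_backprojection

lemma divergence_firstPart : divergence (firstPart f) x = 0 := by
  have htan (η : S2) : innerSL ℝ (η : E3) ∘L tangentWeight η = 0 :=
    ContinuousLinearMap.ext fun v => inner_tangentWeight η v
  have htrace := h.trace_backprojection_derivWeight hf hfi continuous_tangentWeight 3
  rw [divergence_eq_trace, (h.hasFDerivAt_firstPart hf hfi).fderiv,
    ContinuousLinearMap.toLinearMap_smul, map_smul, htrace]
  simp [backprojection, htan]

lemma firstPart_eq_add_gradient {M : ℝ} (hM : ∀ y, ‖f y‖ ≤ M) (hx : ContinuousAt f x) :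
    firstPart f x = f x + gradient (normalPotential f) x := by
  have hsplit : backprojection f tangentWeight 2 x =
      (-(8 * Real.pi ^ 2)) • f x - backprojection f normalWeight 2 x := by
    rw [← h.integral_iteratedDeriv_two hf hfi hM hx]
    exact integral_sub (h.integrable_iteratedDeriv hf hfi 2)
      (h.integrable_backprojection hf hfi continuous_normalWeight 2)
  rw [h.firstPart_eq_smul_backprojection, hsplit, h.gradient_normalPotential hf hfi, smul_sub,
    smul_smul, neg_mul_neg, one_div_mul_cancel (by positivity), one_smul, neg_smul, sub_neg_eq_add]

end IsRadonRegularAt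

end FirstPart

section MaximumPrinciple

lemma deriv_deriv_nonpos_of_isLocalMax {g : ℝ → ℝ} {t : ℝ} (hg : ContinuousAt g t)
    (hm : IsLocalMax g t) : deriv (deriv g) t ≤ 0 := by
  by_contra! hpos
  have hmin := isLocalMin_of_deriv_deriv_pos hpos hm.deriv_eq_zero hg
  have hconst : g =ᶠ[𝓝 t] fun _ => g t := by
    filter_upwards [hm, hmin] with s h₁ h₂ using le_antisymm h₁ h₂
  simp [hconst.deriv.deriv_eq] at hpos

lemma fderiv_fderiv_nonpos_of_isLocalMax {E : Type*} [NormedAddCommGroup E] [NormedSpace ℝ E]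
    {u : E → ℝ} {x : E} (hu : ContDiffAt ℝ 2 u x) (hm : IsLocalMax u x) (v : E) :
    fderiv ℝ (fderiv ℝ u) x v v ≤ 0 := by
  have hline (t : ℝ) : HasDerivAt (fun t : ℝ => x + t • v) v t := by
    simpa using ((hasDerivAt_id t).smul_const v).const_add x
  have htend : Tendsto (fun t : ℝ => x + t • v) (𝓝 0) (𝓝 x) := by
    simpa using (hline 0).continuousAt.tendsto
  have hderiv : deriv (fun t : ℝ => u (x + t • v)) =ᶠ[𝓝 0] fun t => fderiv ℝ u (x + t • v) v := by
    filter_upwards [htend.eventually (hu.eventually (by simp))] with t ht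
    exact ((ht.differentiableAt (by simp)).hasFDerivAt.comp_hasDerivAt t (hline t)).deriv
  have hfderiv : HasFDerivAt (fderiv ℝ u) (fderiv ℝ (fderiv ℝ u) x) (x + (0 : ℝ) • v) := by
    simpa using
      ((hu.fderiv_right (m := 1) (by norm_num)).differentiableAt (by norm_num)).hasFDerivAt
  have hsecond : deriv (deriv fun t : ℝ => u (x + t • v)) 0 = fderiv ℝ (fderiv ℝ u) x v v := by
    have hcomp : HasDerivAt (fun t : ℝ => fderiv ℝ u (x + t • v)) (fderiv ℝ (fderiv ℝ u) x v) 0 :=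
      hfderiv.comp_hasDerivAt 0 (hline 0)
    simpa [hderiv.deriv_eq] using (hcomp.clm_apply (hasDerivAt_const 0 v)).deriv
  rw [← hsecond]
  refine deriv_deriv_nonpos_of_isLocalMax ?_ ?_
  · exact ContinuousAt.comp (f := fun t : ℝ => x + t • v) (by simpa using hu.continuousAt)
      (hline 0).continuousAt
  · simpa [IsLocalMax, IsMaxFilter] using htend.eventually hm

variable {E : Type*} [NormedAddCommGroup E] [InnerProductSpace ℝ E] [FiniteDimensional ℝ E]
  {u : E → ℝ} {D : Set E} {x : E}

lemma laplacian_nonpos_of_isLocalMax (hu : ContDiffAt ℝ 2 u x) (hm : IsLocalMax u x) :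
    Laplacian.laplacian u x ≤ 0 := by
  rw [InnerProductSpace.laplacian_eq_iteratedFDeriv_stdOrthonormalBasis]
  exact Finset.sum_nonpos fun i _ => by
    simpa [iteratedFDeriv_two_apply] using fderiv_fderiv_nonpos_of_isLocalMax hu hm _

lemma laplacian_norm_sq (x : E) :
    Laplacian.laplacian (fun y : E => ‖y‖ ^ 2) x = 2 * Module.finrank ℝ E := by
  have hfderiv : fderiv ℝ (fderiv ℝ fun y : E => ‖y‖ ^ 2) x = 2 • innerSL ℝ (E := E) := by
    rw [fderiv_norm_sq]
    exact (2 • innerSL ℝ (E := E)).fderiv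
  rw [InnerProductSpace.laplacian_eq_iteratedFDeriv_stdOrthonormalBasis]
  simp only [iteratedFDeriv_two_apply, hfderiv]
  calc ∑ i, 2 • inner ℝ (stdOrthonormalBasis ℝ E i) (stdOrthonormalBasis ℝ E i)
    _ = 2 * (Module.finrank ℝ E : ℝ) := by simp [mul_comm]

theorem nonpos_of_laplacian_nonneg [Nontrivial E] (hD : IsOpen D) (hb : Bornology.IsBounded D)
    (hu : ContDiffOn ℝ 2 u D) (hc : ContinuousOn u (closure D))
    (hfrontier : ∀ y ∈ frontier D, u y ≤ 0) (hΔ : ∀ y ∈ D, 0 ≤ Laplacian.laplacian u y)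
    (hx : x ∈ D) : u x ≤ 0 := by
  by_contra! hpos
  obtain ⟨R, hR⟩ := hb.closure.exists_norm_le
  set ε := u x / (R ^ 2 + 1)
  have hε : 0 < ε := by positivity
  have hεR : ε * R ^ 2 < u x := by
    rw [div_mul_eq_mul_div, div_lt_iff₀ (by positivity)]
    linarith
  obtain ⟨z, hz, hmax⟩ := hb.isCompact_closure.exists_isMaxOn ⟨x, subset_closure hx⟩
    (hc.add (by fun_prop : ContinuousOn (fun y => ε * ‖y‖ ^ 2) (closure D)))
  have hzD : z ∈ D := by
    by_contra hzD
    have hxz : u x + ε * ‖x‖ ^ 2 ≤ u z + ε * ‖z‖ ^ 2 := hmax (subset_closure hx)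
    have hle : ε * ‖z‖ ^ 2 ≤ ε * R ^ 2 := by gcongr; exact hR z hz
    have hz0 : u z ≤ 0 := hfrontier z ⟨hz, hD.interior_eq.symm ▸ hzD⟩
    have : 0 ≤ ε * ‖x‖ ^ 2 := by positivity
    linarith
  have huz : ContDiffAt ℝ 2 u z := hu.contDiffAt (hD.mem_nhds hzD)
  have hsq : ContDiffAt ℝ 2 (fun y : E => ‖y‖ ^ 2) z := (contDiff_norm_sq ℝ).contDiffAt
  have hεsq : ContDiffAt ℝ 2 (ε • fun y : E => ‖y‖ ^ 2) z := contDiffAt_const.smul hsq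
  have hle : Laplacian.laplacian (u + ε • fun y : E => ‖y‖ ^ 2) z ≤ 0 :=
    laplacian_nonpos_of_isLocalMax (huz.add hεsq)
      (hmax.isLocalMax (mem_of_superset (hD.mem_nhds hzD) subset_closure))
  rw [huz.laplacian_add hεsq, InnerProductSpace.laplacian_smul ε hsq, laplacian_norm_sq,
    smul_eq_mul] at hle
  have hdim : (0 : ℝ) < Module.finrank ℝ E := mod_cast Module.finrank_pos
  have := hΔ z hzD
  have := mul_pos hε (mul_pos two_pos hdim)
  linarith

theorem eq_zero_of_laplacian_eq_zero [Nontrivial E] (hD : IsOpen D)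
    (hb : Bornology.IsBounded D) (hu : ContDiffOn ℝ 2 u D) (hc : ContinuousOn u (closure D))
    (hfrontier : ∀ y ∈ frontier D, u y = 0) (hΔ : ∀ y ∈ D, Laplacian.laplacian u y = 0)
    (hx : x ∈ D) : u x = 0 := by
  refine le_antisymm (nonpos_of_laplacian_nonneg hD hb hu hc (fun y hy => (hfrontier y hy).le)
    (fun y hy => (hΔ y hy).ge) hx) ?_
  simpa using nonpos_of_laplacian_nonneg hD hb hu.neg hc.neg
    (fun y hy => by simp [hfrontier y hy])
    (fun y hy => by
      change 0 ≤ Laplacian.laplacian (-u) y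
      simp [InnerProductSpace.laplacian_neg, hΔ y hy]) hx

end MaximumPrinciple

section SmoothConvexDomain

variable {D : Set E3} {f fs : E3 → E3} {x : E3}

namespace IsSmoothFieldSupportedIn

lemma exists_eq_indicator (hf : IsSmoothFieldSupportedIn D f) :
    ∃ F : E3 → E3, ContDiff ℝ ∞ F ∧ f = (closure D).indicator F := by
  obtain ⟨⟨F, hF, hfF⟩, hf0⟩ := hf
  refine ⟨F, hF, funext fun y => ?_⟩
  by_cases hy : y ∈ closure D
  · rw [indicator_of_mem hy, hfF hy]
  · rw [indicator_of_notMem hy, hf0 y hy]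

lemma stronglyMeasurable (hf : IsSmoothFieldSupportedIn D f) : StronglyMeasurable f := by
  obtain ⟨F, hF, rfl⟩ := hf.exists_eq_indicator
  exact hF.continuous.stronglyMeasurable.indicator measurableSet_closure

lemma integrable (hf : IsSmoothFieldSupportedIn D f) (hb : Bornology.IsBounded D) :
    Integrable f := by
  obtain ⟨F, hF, rfl⟩ := hf.exists_eq_indicator
  exact (hF.continuous.continuousOn.integrableOn_compact
    hb.isCompact_closure).integrable_indicator measurableSet_closure

lemma exists_norm_le (hf : IsSmoothFieldSupportedIn D f) (hb : Bornology.IsBounded D) :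
    ∃ M, ∀ y, ‖f y‖ ≤ M := by
  obtain ⟨F, hF, rfl⟩ := hf.exists_eq_indicator
  obtain ⟨M, hM⟩ := hb.isCompact_closure.exists_bound_of_continuousOn hF.continuous.continuousOn
  refine ⟨max M 0, fun y => ?_⟩
  by_cases hy : y ∈ closure D
  · rw [indicator_of_mem hy]
    exact (hM y hy).trans (le_max_left _ _)
  · simp [indicator_of_notMem hy]

lemma differentiableAt (hf : IsSmoothFieldSupportedIn D f) (hD : IsOpen D) (hx : x ∈ D) :
    DifferentiableAt ℝ f x := by
  obtain ⟨F, hF, hfF⟩ := hf.1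
  exact (hF.differentiable (by simp) x).congr_of_eventuallyEq
    ((hfF.mono subset_closure).eventuallyEq_of_mem (hD.mem_nhds hx))

lemma exists_isRadonRegularAt (hf : IsSmoothFieldSupportedIn D f) (hD : IsSmoothConvexDomain D)
    (hx : x ∈ D) : ∃ δ, IsRadonRegularAt f x δ := by
  obtain ⟨F, hF, rfl⟩ := hf.exists_eq_indicator
  exact hD.exists_isRadonRegularAt hF hx

variable (hf : IsSmoothFieldSupportedIn D f) (hD : IsSmoothConvexDomain D)

include hf hD

lemma contDiffAt_radonTan (hx : x ∈ D) (η : S2) :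
    ContDiffAt ℝ ∞ (fun p => radonTan f p η) (inner ℝ (η : E3) x) := by
  obtain ⟨δ, h⟩ := hf.exists_isRadonRegularAt hD hx
  exact h.contDiffAt_radonTan η

lemma integrable_radonTanSecond (hx : x ∈ D) :
    Integrable (radonTanSecond f x) surfaceMeasure := by
  obtain ⟨δ, h⟩ := hf.exists_isRadonRegularAt hD hx
  exact h.integrable_radonTanSecond hf.stronglyMeasurable (hf.integrable hD.isBounded)

lemma differentiableAt_firstPart (hx : x ∈ D) : DifferentiableAt ℝ (firstPart f) x := by
  obtain ⟨δ, h⟩ := hf.exists_isRadonRegularAt hD hx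
  exact (h.hasFDerivAt_firstPart hf.stronglyMeasurable
    (hf.integrable hD.isBounded)).differentiableAt

lemma divergence_firstPart (hx : x ∈ D) : divergence (firstPart f) x = 0 := by
  obtain ⟨δ, h⟩ := hf.exists_isRadonRegularAt hD hx
  exact h.divergence_firstPart hf.stronglyMeasurable (hf.integrable hD.isBounded)

lemma contDiffAt_normalPotential (hx : x ∈ D) : ContDiffAt ℝ 2 (normalPotential f) x := by
  obtain ⟨δ, h⟩ := hf.exists_isRadonRegularAt hD hx
  exact (h.contDiffOn_normalPotential hf.stronglyMeasurable (hf.integrable hD.isBounded)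
    2).contDiffAt (ball_mem_nhds x h.pos)

lemma firstPart_eq_add_gradient (hx : x ∈ D) :
    firstPart f x = f x + gradient (normalPotential f) x := by
  obtain ⟨δ, h⟩ := hf.exists_isRadonRegularAt hD hx
  obtain ⟨M, hM⟩ := hf.exists_norm_le hD.isBounded
  exact h.firstPart_eq_add_gradient hf.stronglyMeasurable (hf.integrable hD.isBounded) hM
    (hf.differentiableAt hD.isOpen hx).continuousAt

lemma curl_firstPart (hx : x ∈ D) : curl (firstPart f) x = curl f x :=
  curl_eq_of_eventuallyEq_add_gradient
    (Filter.mem_of_superset (hD.isOpen.mem_nhds hx) fun _ hy => hf.firstPart_eq_add_gradient hD hy)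
    (hf.differentiableAt hD.isOpen hx) (hf.contDiffAt_normalPotential hD hx)

end IsSmoothFieldSupportedIn

lemma harmonicOnNhd_of_eq_add_gradient {F G : E3 → E3} {u : E3 → ℝ} (hD : IsOpen D)
    (hF : DifferentiableOn ℝ F D) (hu : ContDiffOn ℝ 2 u D)
    (hG : ∀ y ∈ D, G y = F y + gradient u y) (hdiv : ∀ y ∈ D, divergence G y = divergence F y) :
    InnerProductSpace.HarmonicOnNhd u D := by
  have hΔ (y) (hy : y ∈ D) : Laplacian.laplacian u y = 0 := by
    have hsum := divergence_eq_add_laplacian (mem_of_superset (hD.mem_nhds hy) hG)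
      (hF.differentiableAt (hD.mem_nhds hy)) (hu.contDiffAt (hD.mem_nhds hy))
    linarith [hdiv y hy]
  exact fun y hy => ⟨hu.contDiffAt (hD.mem_nhds hy), mem_of_superset (hD.mem_nhds hy) hΔ⟩

lemma exists_harmonicOnNhd_sub_eq_gradient (hD : IsSmoothConvexDomain D)
    (hf : IsSmoothFieldSupportedIn D f) (hfs : IsSolenoidalPart D f fs) :
    ∃ u : E3 → ℝ, InnerProductSpace.HarmonicOnNhd u D ∧
      ∀ y ∈ D, fs y - firstPart f y = gradient u y := by
  obtain ⟨φ, hφ, -, -, hdecomp, hdiv⟩ := hfs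
  have hψ (y) (hy : y ∈ D) : ContDiffAt ℝ 2 (normalPotential f) y :=
    hf.contDiffAt_normalPotential hD hy
  have hgrad (y) (hy : y ∈ D) :
      fs y - firstPart f y = gradient (-(φ + normalPotential f)) y := by
    have hφy := (hφ.contDiffAt (hD.isOpen.mem_nhds hy)).differentiableAt two_ne_zero
    rw [hf.firstPart_eq_add_gradient hD hy, hdecomp y hy]
    simp only [gradient]
    rw [fderiv_neg, fderiv_add hφy ((hψ y hy).differentiableAt two_ne_zero), map_neg, map_add]
    abel
  refine ⟨-(φ + normalPotential f), ?_, hgrad⟩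
  refine harmonicOnNhd_of_eq_add_gradient (G := fs) hD.isOpen
    (fun y hy => (hf.differentiableAt_firstPart hD hy).differentiableWithinAt)
    (hφ.add fun y hy => (hψ y hy).contDiffWithinAt).neg (fun y hy => ?_) fun y hy => ?_
  · rw [← hgrad y hy, add_sub_cancel]
  · rw [hdiv y hy, hf.divergence_firstPart hD hy]

lemma eq_of_isSolenoidalPart_of_divergence_eq_zero (hD : IsOpen D) (hb : Bornology.IsBounded D)
    (hf : DifferentiableOn ℝ f D) (hdiv : ∀ y ∈ D, divergence f y = 0)
    (hfs : IsSolenoidalPart D f fs) (hx : x ∈ D) : fs x = f x := by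
  obtain ⟨φ, hφ, hc, hfrontier, hdecomp, hdivs⟩ := hfs
  have hneg (y) : gradient (-φ) y = -gradient φ y := by
    rw [gradient, fderiv_neg, map_neg, ← gradient]
  have hharm : InnerProductSpace.HarmonicOnNhd (-φ) D :=
    harmonicOnNhd_of_eq_add_gradient (G := fs) hD hf hφ.neg
      (fun y hy => by rw [hdecomp y hy, hneg, add_neg_cancel_right])
      fun y hy => by rw [hdivs y hy, hdiv y hy]
  have hzero : -φ =ᶠ[𝓝 x] fun _ => 0 := mem_of_superset (hD.mem_nhds hx) fun y hy =>
    eq_zero_of_laplacian_eq_zero hD hb hφ.neg hc.neg (fun z hz => by simp [hfrontier z hz])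
      (fun z hz => (hharm z hz).2.self_of_nhds) hy
  have hgrad : gradient (-φ) x = 0 := by simp [gradient, hzero.fderiv_eq]
  rw [hdecomp x hx, neg_eq_zero.1 ((hneg x).symm.trans hgrad), add_zero]

end SmoothConvexDomain

section TangentialField

lemma integral_mul_divergence {β : E3 → ℝ} {w : E3 → E3} (hβ : ContDiff ℝ 1 β)
    (hβc : HasCompactSupport β) (hw : ContDiff ℝ 1 w) :
    ∫ y, β y * divergence w y = -∫ y, fderiv ℝ β y (w y) := by
  set e : Fin 3 → E3 := fun i => EuclideanSpace.single i 1
  have hwi (i) : ContDiff ℝ 1 fun y => w y i := contDiff_euclidean.1 hw i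
  have hβ' : Continuous (fderiv ℝ β) := hβ.continuous_fderiv one_ne_zero
  have hint {g : E3 → ℝ} (hg : Continuous g) : Integrable fun y => β y * g y :=
    (hβ.continuous.mul hg).integrable_of_hasCompactSupport hβc.mul_right
  have hint' (i) : Integrable fun y => fderiv ℝ β y (e i) * w y i :=
    ((hβ'.clm_apply continuous_const).mul (hwi i).continuous).integrable_of_hasCompactSupport
      ((hβc.fderiv_apply ℝ (e i)).mul_right)
  have hpartial (i) : Continuous fun y => fderiv ℝ (fun z => w z i) y (e i) :=
    ((hwi i).continuous_fderiv one_ne_zero).clm_apply continuous_const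
  have hdiv (y) : divergence w y = ∑ i, fderiv ℝ (fun z => w z i) y (e i) := by
    refine Finset.sum_congr rfl fun i _ => ?_
    have hcoord := (EuclideanSpace.proj (𝕜 := ℝ) i).hasFDerivAt.comp y
      (hw.differentiable one_ne_zero y).hasFDerivAt
    exact (congrArg (fun A : E3 →L[ℝ] ℝ => A (e i)) hcoord.fderiv).symm
  have happly (y) : fderiv ℝ β y (w y) = ∑ i, fderiv ℝ β y (e i) * w y i := by
    have hbasis := (EuclideanSpace.basisFun (Fin 3) ℝ).sum_repr (w y)
    conv_lhs => rw [← hbasis]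
    simp [e, mul_comm]
  simp only [hdiv, happly, Finset.mul_sum]
  rw [integral_finsetSum _ fun i _ => hint (hpartial i), integral_finsetSum _ fun i _ => hint' i,
    ← Finset.sum_neg_distrib]
  exact Finset.sum_congr rfl fun i _ =>
    integral_mul_fderiv_eq_neg_fderiv_mul_of_integrable (hint' i) (hint (hpartial i))
      (hint (hwi i).continuous) (fun y _ => hβ.differentiable one_ne_zero y)
      fun y _ => (hwi i).differentiable one_ne_zero y

lemma deriv_smoothTransition_eq_zero_of_one_lt {t : ℝ} (ht : 1 < t) :
    deriv Real.smoothTransition t = 0 := by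
  have hone : Real.smoothTransition =ᶠ[𝓝 t] fun _ => 1 := by
    filter_upwards [Ioi_mem_nhds ht] with s hs using Real.smoothTransition.one_of_one_le hs.le
  rw [hone.deriv_eq, deriv_const]

lemma exists_abs_deriv_smoothTransition_mul_le :
    ∃ C, ∀ t, 0 ≤ t → |deriv Real.smoothTransition t * t| ≤ C := by
  have hderiv : Continuous (deriv Real.smoothTransition) :=
    (Real.smoothTransition.contDiff (n := 1)).continuous_deriv le_rfl
  obtain ⟨C, hC⟩ := (isCompact_Icc (a := (0 : ℝ)) (b := 1)).exists_bound_of_continuousOn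
    (hderiv.mul continuous_id).continuousOn
  refine ⟨max C 0, fun t ht => ?_⟩
  rcases le_or_gt t 1 with ht1 | ht1
  · exact (hC t ⟨ht, ht1⟩).trans (le_max_left _ _)
  · simp [deriv_smoothTransition_eq_zero_of_one_lt ht1]

section SuperlevelSet

variable {ρ : E3 → ℝ} {w : E3 → E3}

lemma fderiv_smoothTransition_comp (hρ : ContDiff ℝ 1 ρ) (n : ℕ) (y v : E3) :
    fderiv ℝ (fun z => Real.smoothTransition (n * ρ z)) y v =
      deriv Real.smoothTransition (n * ρ y) * (n * fderiv ℝ ρ y v) := by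
  have hS : DifferentiableAt ℝ Real.smoothTransition (n * ρ y) :=
    (Real.smoothTransition.contDiff (n := 1)).differentiable one_ne_zero _
  have hρy := (hρ.differentiable one_ne_zero y).hasFDerivAt
  have hcomp : HasFDerivAt (fun z => Real.smoothTransition (n * ρ z))
      (deriv Real.smoothTransition (n * ρ y) • (n : ℝ) • fderiv ℝ ρ y) y :=
    HasDerivAt.comp_hasFDerivAt (h₂ := Real.smoothTransition) y hS.hasDerivAt (hρy.const_mul _)
  simp [hcomp.fderiv]

lemma smoothTransition_mul_eq_zero (n : ℕ) {t : ℝ} (ht : t ≤ 0) :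
    Real.smoothTransition (n * t) = 0 :=
  Real.smoothTransition.zero_of_nonpos (mul_nonpos_of_nonneg_of_nonpos n.cast_nonneg ht)

lemma fderiv_smoothTransition_comp_eq_zero (n : ℕ) {y : E3} (hy : ρ y ≤ 0) :
    fderiv ℝ (fun z => Real.smoothTransition (n * ρ z)) y = 0 :=
  IsLocalMin.fderiv_eq_zero <| Eventually.of_forall fun _ =>
    (smoothTransition_mul_eq_zero n hy).trans_le (Real.smoothTransition.nonneg _)

lemma tendsto_integral_smoothTransition_mul {g : E3 → ℝ} (hρ : Continuous ρ)
    (hb : Bornology.IsBounded {y | 0 < ρ y}) (hg : Continuous g) :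
    Tendsto (fun n : ℕ => ∫ y, Real.smoothTransition (n * ρ y) * g y) atTop
      (𝓝 (∫ y in {y | 0 < ρ y}, g y)) := by
  have hmeas : MeasurableSet {y | 0 < ρ y} := (isOpen_lt continuous_const hρ).measurableSet
  have hgi : IntegrableOn g {y | 0 < ρ y} :=
    (hg.continuousOn.integrableOn_compact hb.isCompact_closure).mono_set subset_closure
  rw [← integral_indicator hmeas]
  refine tendsto_integral_of_dominated_convergence (fun y => ‖{y | 0 < ρ y}.indicator g y‖)
    (fun n => ?_) (hgi.integrable_indicator hmeas).norm (fun n => ?_) ?_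
  · have := Real.smoothTransition.continuous
    exact (show Continuous _ by fun_prop).aestronglyMeasurable
  · refine Eventually.of_forall fun y => ?_
    rcases le_or_gt (ρ y) 0 with hy | hy
    · simp [smoothTransition_mul_eq_zero n hy, hy.not_gt]
    · rw [indicator_of_mem (by exact hy), norm_mul, Real.norm_of_nonneg
        (Real.smoothTransition.nonneg _)]
      exact mul_le_of_le_one_left (norm_nonneg _) (Real.smoothTransition.le_one _)
  · refine Eventually.of_forall fun y => tendsto_const_nhds.congr' ?_
    rcases le_or_gt (ρ y) 0 with hy | hy
    · exact Eventually.of_forall fun n => by simp [smoothTransition_mul_eq_zero n hy, hy.not_gt]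
    · filter_upwards [(tendsto_natCast_atTop_atTop.atTop_mul_const hy).eventually_ge_atTop 1]
        with n hn
      rw [indicator_of_mem (by exact hy), Real.smoothTransition.one_of_one_le hn, one_mul]

-- The gradient of the cutoff is of order `n`, but only where `ρ ≤ 1 / n`; tangency makes up for it.
lemma exists_norm_fderiv_smoothTransition_comp_le (hρ : ContDiff ℝ 1 ρ) {L : ℝ}
    (hL : ∀ y, 0 < ρ y → |fderiv ℝ ρ y (w y)| ≤ L * ρ y) :
    ∃ C, ∀ (n : ℕ) (y : E3), 0 < ρ y →
      ‖fderiv ℝ (fun z => Real.smoothTransition (n * ρ z)) y (w y)‖ ≤ C := by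
  obtain ⟨C, hC⟩ := exists_abs_deriv_smoothTransition_mul_le
  refine ⟨C * L, fun n y hy => ?_⟩
  have hL0 : 0 ≤ L := nonneg_of_mul_nonneg_left ((abs_nonneg _).trans (hL y hy)) hy
  rw [fderiv_smoothTransition_comp hρ, Real.norm_eq_abs]
  calc |deriv Real.smoothTransition (n * ρ y) * (n * fderiv ℝ ρ y (w y))|
    _ = |deriv Real.smoothTransition (n * ρ y)| * (n * |fderiv ℝ ρ y (w y)|) := by
      rw [abs_mul, abs_mul, Nat.abs_cast]
    _ ≤ |deriv Real.smoothTransition (n * ρ y)| * (n * (L * ρ y)) := by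
      gcongr
      exact hL y hy
    _ = |deriv Real.smoothTransition (n * ρ y) * (n * ρ y)| * L := by
      rw [abs_mul, abs_of_nonneg (by positivity : 0 ≤ n * ρ y)]
      ring
    _ ≤ C * L := mul_le_mul_of_nonneg_right (hC _ (by positivity)) hL0

lemma tendsto_integral_fderiv_smoothTransition (hρ : ContDiff ℝ 1 ρ)
    (hb : Bornology.IsBounded {y | 0 < ρ y}) (hw : Continuous w) {L : ℝ}
    (hL : ∀ y, 0 < ρ y → |fderiv ℝ ρ y (w y)| ≤ L * ρ y) :
    Tendsto (fun n : ℕ => ∫ y, fderiv ℝ (fun z => Real.smoothTransition (n * ρ z)) y (w y)) atTop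
      (𝓝 0) := by
  obtain ⟨C, hC⟩ := exists_norm_fderiv_smoothTransition_comp_le hρ hL
  have hmeas : MeasurableSet {y | 0 < ρ y} :=
    (isOpen_lt continuous_const hρ.continuous).measurableSet
  rw [← integral_zero E3 ℝ (μ := volume)]
  refine tendsto_integral_of_dominated_convergence ({y | 0 < ρ y}.indicator fun _ => C)
    (fun n => ?_) ((integrableOn_const hb.measure_lt_top.ne).integrable_indicator hmeas)
    (fun n => ?_) ?_
  · have hcut : ContDiff ℝ 1 fun z => Real.smoothTransition (n * ρ z) :=
      Real.smoothTransition.contDiff.comp (contDiff_const.mul hρ)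
    exact ((hcut.continuous_fderiv one_ne_zero).clm_apply hw).aestronglyMeasurable
  · refine Eventually.of_forall fun y => ?_
    rcases le_or_gt (ρ y) 0 with hy | hy
    · simp [fderiv_smoothTransition_comp_eq_zero n hy, hy.not_gt]
    · simpa [hy] using hC n y hy
  · refine Eventually.of_forall fun y => tendsto_const_nhds.congr' ?_
    rcases le_or_gt (ρ y) 0 with hy | hy
    · exact Eventually.of_forall fun n => by
        simp [fderiv_smoothTransition_comp_eq_zero n hy]
    · filter_upwards [(tendsto_natCast_atTop_atTop.atTop_mul_const hy).eventually_gt_atTop 1]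
        with n hn
      rw [fderiv_smoothTransition_comp hρ, deriv_smoothTransition_eq_zero_of_one_lt hn, zero_mul]

theorem setIntegral_divergence_eq_zero (hρ : ContDiff ℝ 1 ρ)
    (hb : Bornology.IsBounded {y | 0 < ρ y}) (hw : ContDiff ℝ 1 w) {L : ℝ}
    (hL : ∀ y, 0 < ρ y → |fderiv ℝ ρ y (w y)| ≤ L * ρ y) :
    ∫ y in {y | 0 < ρ y}, divergence w y = 0 := by
  have hparts (n : ℕ) : ∫ y, Real.smoothTransition (n * ρ y) * divergence w y =
      -∫ y, fderiv ℝ (fun z => Real.smoothTransition (n * ρ z)) y (w y) := by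
    refine integral_mul_divergence (Real.smoothTransition.contDiff.comp (contDiff_const.mul hρ))
      (HasCompactSupport.intro hb.isCompact_closure fun y hy => ?_) hw
    exact smoothTransition_mul_eq_zero n (not_lt.1 fun h => hy (subset_closure h))
  have hdiv : Continuous (divergence w) := by
    have := hw.continuous_fderiv one_ne_zero
    unfold divergence partialDeriv
    fun_prop
  refine tendsto_nhds_unique (tendsto_integral_smoothTransition_mul hρ.continuous hb hdiv) ?_
  simp only [hparts]
  simpa using (tendsto_integral_fderiv_smoothTransition hρ hb hw.continuous hL).neg

end SuperlevelSet

lemma exists_mem_sphere_norm_sub_eq (y : E3) (hy : y ∈ ball (0 : E3) 1) :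
    ∃ θ ∈ sphere (0 : E3) 1, ‖y - θ‖ = 1 - ‖y‖ := by
  rcases eq_or_ne y 0 with rfl | hy0
  · obtain ⟨θ, hθ⟩ := exists_norm_eq E3 zero_le_one
    exact ⟨θ, by simpa using hθ, by simp [hθ]⟩
  · have hn : ‖y‖ ≠ 0 := norm_ne_zero_iff.2 hy0
    have hy1 : ‖y‖ < 1 := mem_ball_zero_iff.1 hy
    refine ⟨‖y‖⁻¹ • y, by simp [norm_smul, hn], ?_⟩
    calc ‖y - ‖y‖⁻¹ • y‖ = ‖(‖y‖⁻¹ * (1 - ‖y‖)) • -y‖ := by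
          congr 1
          rw [mul_sub, inv_mul_cancel₀ hn]
          module
      _ = 1 - ‖y‖ := by
          rw [norm_smul, norm_neg, norm_mul, norm_inv, norm_norm,
            Real.norm_of_nonneg (sub_nonneg.2 hy1.le)]
          field_simp

lemma exists_abs_le_mul_one_sub_norm_sq {g : E3 → ℝ} (hg : ContDiff ℝ 1 g)
    (h0 : ∀ θ ∈ sphere (0 : E3) 1, g θ = 0) :
    ∃ L, ∀ y ∈ ball (0 : E3) 1, |g y| ≤ L * (1 - ‖y‖ ^ 2) := by
  obtain ⟨L, hL⟩ := (isCompact_closedBall (0 : E3) 1).exists_bound_of_continuousOn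
    (hg.continuous_fderiv one_ne_zero).continuousOn
  refine ⟨L, fun y hy => ?_⟩
  have hL0 : 0 ≤ L := (norm_nonneg _).trans (hL y (ball_subset_closedBall hy))
  have hy1 : ‖y‖ < 1 := mem_ball_zero_iff.1 hy
  obtain ⟨θ, hθ, hdist⟩ := exists_mem_sphere_norm_sub_eq y hy
  calc |g y| = ‖g y - g θ‖ := by rw [h0 θ hθ, sub_zero, Real.norm_eq_abs]
    _ ≤ L * ‖y - θ‖ := (convex_closedBall (0 : E3) 1).norm_image_sub_le_of_norm_fderiv_le
        (fun z _ => hg.differentiable one_ne_zero z) hL (sphere_subset_closedBall hθ)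
        (ball_subset_closedBall hy)
    _ ≤ L * (1 - ‖y‖ ^ 2) := by
      rw [hdist]
      gcongr
      nlinarith [norm_nonneg y]

lemma divergence_smul {u : E3 → ℝ} {F : E3 → E3} {y : E3} (hu : DifferentiableAt ℝ u y)
    (hF : DifferentiableAt ℝ F y) :
    divergence (fun z => u z • F z) y = u y * divergence F y + fderiv ℝ u y (F y) := by
  rw [divergence_eq_trace, divergence_eq_trace, fderiv_fun_smul hu hF]
  simp

theorem setIntegral_ball_fderiv_eq_zero {u : E3 → ℝ} {F : E3 → E3} (hu : ContDiff ℝ 1 u)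
    (hF : ContDiff ℝ 1 F) (hdiv : ∀ y ∈ ball (0 : E3) 1, divergence F y = 0)
    (htan : ∀ θ ∈ sphere (0 : E3) 1, inner ℝ (F θ) θ = 0) :
    ∫ y in ball (0 : E3) 1, fderiv ℝ u y (F y) = 0 := by
  set ρ : E3 → ℝ := fun y => 1 - ‖y‖ ^ 2
  have hρ : ContDiff ℝ 1 ρ := contDiff_const.sub (contDiff_norm_sq ℝ)
  have hball : {y | 0 < ρ y} = ball 0 1 := by
    ext y
    simp [ρ]
  have hw : ContDiff ℝ 1 fun y => u y • F y := hu.smul hF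
  have hflow (y) : fderiv ℝ ρ y (u y • F y) = -(2 * (u y * inner ℝ (F y) y)) := by
    rw [real_inner_comm, fderiv_const_sub, neg_apply, map_smul, fderiv_norm_sq_apply]
    simp
    ring
  obtain ⟨L, hL⟩ := exists_abs_le_mul_one_sub_norm_sq
    (g := fun y => fderiv ℝ ρ y (u y • F y))
    (by simp only [hflow]; exact (contDiff_const.mul (hu.mul (hF.inner ℝ contDiff_id))).neg)
    fun θ hθ => by simp [hflow, htan θ hθ]
  have hflux := setIntegral_divergence_eq_zero hρ (hball ▸ isBounded_ball) hw
    fun y hy => hL y (hball ▸ hy)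
  rw [hball] at hflux
  rw [← hflux]
  refine setIntegral_congr_fun measurableSet_ball fun y hy => ?_
  rw [divergence_smul (hu.differentiable one_ne_zero y) (hF.differentiable one_ne_zero y),
    hdiv y hy, mul_zero, zero_add]

end TangentialField

section UnitBall

lemma isSmoothConvexDomain_ball : IsSmoothConvexDomain (ball (0 : E3) 1) where
  isOpen := isOpen_ball
  convex := convex_ball 0 1
  isBounded := isBounded_ball
  hasSmoothBoundary x hx := by
    rw [frontier_ball (0 : E3) one_ne_zero, mem_sphere_zero_iff_norm] at hx
    refine ⟨fun y => ‖y‖ ^ 2 - 1, (contDiff_norm_sq ℝ).sub contDiff_const, fun h => ?_,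
      Eventually.of_forall fun y => ?_⟩
    · have hradial := DFunLike.congr_fun h x
      rw [fderiv_sub_const, fderiv_norm_sq_apply] at hradial
      simp [hx] at hradial
    · rw [mem_ball_zero_iff, sub_neg, sq_lt_one_iff₀ (norm_nonneg y)]

variable {f : E3 → E3} {x : E3}

lemma fderiv_planeWave {ψ : ℝ → ℝ} (hψ : Continuous ψ) (η y v : E3) :
    fderiv ℝ (fun z => ∫ s in (0 : ℝ)..inner ℝ η z, ψ s) y v = ψ (inner ℝ η y) * inner ℝ η v := by
  have hderiv : HasDerivAt (fun q => ∫ s in (0 : ℝ)..q, ψ s) (ψ (inner ℝ η y)) (inner ℝ η y) :=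
    hψ.integral_hasStrictDerivAt 0 _ |>.hasDerivAt
  have hcomp : HasFDerivAt (fun z => ∫ s in (0 : ℝ)..inner ℝ η z, ψ s)
      (ψ (inner ℝ η y) • innerSL ℝ η) y :=
    HasDerivAt.comp_hasFDerivAt (h₂ := fun q => ∫ s in (0 : ℝ)..q, ψ s) y hderiv
      (innerSL ℝ η).hasFDerivAt
  simp [hcomp.fderiv]

lemma contDiff_planeWave {ψ : ℝ → ℝ} (hψ : Continuous ψ) (η : E3) :
    ContDiff ℝ 1 fun z => ∫ s in (0 : ℝ)..inner ℝ η z, ψ s := by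
  have hderiv (q : ℝ) := (hψ.integral_hasStrictDerivAt 0 q).hasDerivAt
  have hprimitive : ContDiff ℝ 1 fun q => ∫ s in (0 : ℝ)..q, ψ s :=
    contDiff_one_iff_deriv.2
      ⟨fun q => (hderiv q).differentiableAt, by rwa [funext fun q => (hderiv q).deriv]⟩
  exact hprimitive.comp (contDiff_const.inner ℝ contDiff_id)

variable (hf : IsSmoothFieldSupportedIn (ball 0 1) f)
  (hdiv : ∀ y ∈ ball (0 : E3) 1, divergence f y = 0)
  (htan : ∀ θ ∈ sphere (0 : E3) 1, inner ℝ (f θ) θ = 0)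

include hf hdiv htan

lemma integral_mul_inner_eq_zero (η : E3) {ψ : ℝ → ℝ} (hψ : Continuous ψ) :
    ∫ y, ψ (inner ℝ η y) * inner ℝ η (f y) = 0 := by
  obtain ⟨F, hF, hfF⟩ := hf.1
  have hF1 : ContDiff ℝ 1 F := hF.of_le (by simp)
  have hFdiv (y) (hy : y ∈ ball (0 : E3) 1) : divergence F y = 0 := by
    have hev := (hfF.mono subset_closure).eventuallyEq_of_mem (isOpen_ball.mem_nhds hy)
    rw [← hdiv y hy, divergence_eq_trace, divergence_eq_trace, hev.fderiv_eq]
  have hFtan (θ) (hθ : θ ∈ sphere (0 : E3) 1) : inner ℝ (F θ) θ = 0 := by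
    rw [← hfF (closure_ball (0 : E3) one_ne_zero ▸ sphere_subset_closedBall hθ), htan θ hθ]
  rw [← setIntegral_ball_fderiv_eq_zero (contDiff_planeWave hψ η) hF1 hFdiv hFtan,
    ← integral_indicator measurableSet_ball]
  have hsphere : ∀ᵐ y : E3, y ∉ sphere (0 : E3) 1 :=
    measure_eq_zero_iff_ae_notMem.1 (Measure.addHaar_sphere volume 0 1)
  refine integral_congr_ae (hsphere.mono fun y hy => ?_)
  beta_reduce
  by_cases hyb : y ∈ ball (0 : E3) 1
  · rw [indicator_of_mem hyb, fderiv_planeWave hψ, hfF (subset_closure hyb)]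
  · have hy' : y ∉ closure (ball (0 : E3) 1) := by
      rw [closure_ball (0 : E3) one_ne_zero, ← ball_union_sphere]
      exact fun h => h.elim hyb hy
    simp [indicator_of_notMem hyb, hf.2 y hy']

lemma integral_mul_inner_radon_eq_zero {η : E3} (hη : ‖η‖ = 1) {ψ : ℝ → ℝ} (hψ : Continuous ψ)
    (hψc : HasCompactSupport ψ) : ∫ p, ψ p * inner ℝ η (radon f p η) = 0 := by
  have hfi : Integrable f := hf.integrable isBounded_ball
  obtain ⟨C, hC⟩ := hψ.bounded_above_of_compact_support hψc
  have hwave : Integrable fun y => ψ (inner ℝ η y) • f y :=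
    hfi.bdd_smul C (by fun_prop : Continuous fun y => ψ (inner ℝ η y)).aestronglyMeasurable
      (Eventually.of_forall fun y => hC _)
  have hradon : Integrable fun p => ψ p • radon f p η :=
    (integrable_radon hη hfi).bdd_smul C hψ.aestronglyMeasurable (Eventually.of_forall hC)
  calc ∫ p, ψ p * inner ℝ η (radon f p η)
    _ = inner ℝ η (∫ p, ψ p • radon f p η) := by
      simp only [← integral_inner hradon, real_inner_smul_right]
    _ = ∫ y, ψ (inner ℝ η y) * inner ℝ η (f y) := by
      rw [← integral_inner_smul_eq_integral_radon hη hwave, ← integral_inner hwave]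
      simp only [real_inner_smul_right]
    _ = 0 := integral_mul_inner_eq_zero hf hdiv htan η hψ

lemma inner_radon_eq_zero (η : S2) {p : ℝ} (hp : p ∈ Ioo (-1 : ℝ) 1) :
    inner ℝ (η : E3) (radon f p η) = 0 := by
  have hη : ‖(η : E3)‖ = 1 := norm_eq_of_mem_sphere η
  have hcont : ContinuousOn (fun p => inner ℝ (η : E3) (radon f p η)) (Ioo (-1) 1) := by
    intro q hq
    have hmem : q • (η : E3) ∈ ball (0 : E3) 1 := by
      rw [mem_ball_zero_iff, norm_smul, hη, mul_one]
      exact abs_lt.2 hq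
    obtain ⟨δ, h⟩ := hf.exists_isRadonRegularAt isSmoothConvexDomain_ball hmem
    have hq' : inner ℝ (η : E3) (q • (η : E3)) = q := by simp [inner_smul_right, hη]
    exact (continuousAt_const.inner (hq' ▸ h.contDiffAt_radon η).continuousAt).continuousWithinAt
  have hae := isOpen_Ioo.ae_eq_zero_of_integral_contDiff_smul_eq_zero
    (hcont.locallyIntegrableOn measurableSet_Ioo) fun ψ hψ hψc _ =>
      integral_mul_inner_radon_eq_zero hf hdiv htan hη hψ.continuous hψc
  exact Measure.eqOn_open_of_ae_eq ((ae_restrict_iff' measurableSet_Ioo).2 hae) isOpen_Ioo hcont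
    continuousOn_const hp

theorem firstPart_eq_self (hx : x ∈ ball (0 : E3) 1) : firstPart f x = f x := by
  have hD := isSmoothConvexDomain_ball
  obtain ⟨δ, h⟩ := hf.exists_isRadonRegularAt hD hx
  obtain ⟨M, hM⟩ := hf.exists_norm_le hD.isBounded
  have hsecond (η : S2) : radonTanSecond f x η =
      iteratedDeriv 2 (fun p => radon f p η) (inner ℝ (η : E3) x) := by
    have hmem : inner ℝ (η : E3) x ∈ Ioo (-1 : ℝ) 1 := by
      rw [mem_Ioo, ← abs_lt]
      refine (abs_real_inner_le_norm _ _).trans_lt ?_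
      rwa [norm_eq_of_mem_sphere η, one_mul, ← mem_ball_zero_iff]
    refine EventuallyEq.iteratedDeriv_eq 2 ?_
    filter_upwards [isOpen_Ioo.mem_nhds hmem] with p hp
    rw [radonTan, radonNor, inner_radon_eq_zero hf hdiv htan η hp, zero_smul, sub_zero]
  rw [firstPart, integral_congr_ae (Eventually.of_forall hsecond),
    h.integral_iteratedDeriv_two hf.stronglyMeasurable (hf.integrable hD.isBounded) hM
      (hf.differentiableAt hD.isOpen hx).continuousAt, smul_smul, neg_mul_neg,
    one_div_mul_cancel (by positivity), one_smul]

end UnitBall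

theorem mainTheorem2 :
    (∀ (D : Set E3) (f : E3 → E3),
      IsOpen D → Convex ℝ D → Bornology.IsBounded D → HasSmoothBoundary D →
      IsSmoothFieldSupportedIn D f →
        -- the integral that defines the first part makes sense, and gives a differentiable field
        (∀ x ∈ D,
          (∀ η : S2, ContDiffAt ℝ 2 (fun p : ℝ => radonTan f p (η : E3)) (inner ℝ (η : E3) x)) ∧
          MeasureTheory.Integrable (radonTanSecond f x) surfaceMeasure) ∧
        DifferentiableOn ℝ (firstPart f) D ∧
        (∀ x ∈ D, curl f x = curl (firstPart f) x) ∧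
        (∀ x ∈ D, divergence (firstPart f) x = 0) ∧
        (∀ fs : E3 → E3, IsSolenoidalPart D f fs →
          ∃ h : E3 → ℝ, InnerProductSpace.HarmonicOnNhd h D ∧
            ∀ x ∈ D, fs x - firstPart f x = gradient h x)) ∧
    (∀ f : E3 → E3, IsSmoothFieldSupportedIn (Metric.ball 0 1) f →
      (∀ x ∈ Metric.ball (0 : E3) 1, divergence f x = 0) →
      (∀ η ∈ Metric.sphere (0 : E3) 1, inner ℝ (f η) η = 0) →
      ∀ fs : E3 → E3, IsSolenoidalPart (Metric.ball 0 1) f fs →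
        ∀ x ∈ Metric.ball (0 : E3) 1, secondPart f fs x = 0) := by
  refine ⟨fun D f hopen hconvex hbounded hsmooth hf => ?_, fun f hf hdiv htan fs hfs x hx => ?_⟩
  · have hD : IsSmoothConvexDomain D := ⟨hopen, hconvex, hbounded, hsmooth⟩
    exact ⟨fun x hx => ⟨fun η => (hf.contDiffAt_radonTan hD hx η).of_le ENat.LEInfty.out,
        hf.integrable_radonTanSecond hD hx⟩,
      fun x hx => (hf.differentiableAt_firstPart hD hx).differentiableWithinAt,
      fun x hx => (hf.curl_firstPart hD hx).symm,
      fun x hx => hf.divergence_firstPart hD hx,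
      fun fs => exists_harmonicOnNhd_sub_eq_gradient hD hf⟩
  · have hfd : DifferentiableOn ℝ f (ball 0 1) := fun y hy =>
      (hf.differentiableAt isOpen_ball hy).differentiableWithinAt
    rw [secondPart, firstPart_eq_self hf hdiv htan hx, sub_eq_zero]
    exact eq_of_isSolenoidalPart_of_divergence_eq_zero isOpen_ball isBounded_ball hfd hdiv hfs hx
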